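/- **Proposition.** Let $E_1,\dots,E_k$ be real Banach spaces, let $\Omega_i\subset E_i$ be bounded contractible open sets, and put $\mathbf\Omega=\Omega_1\times\cdots\times\Omega_k\subset E_1\times\cdots\times E_k$. For $i=1,\dots,k$ let $$G_i:\overline{\Omega_1}\times\cdots\times\overline{\Omega_k}\to E_i$$ be a compact map (continuous, with relatively compact image), write $\mathbf G=(G_1,\dots,G_k)$, and let $\mathbf p=(p_1,\dots,p_k)$ with $p_i\in E_i$. For $\mathbf x=(x_1,\dots,x_k)\in\mathbf\Omega$ let $(I-G_i)^{\mathbf x}:\overline{\Omega_i}\to E_i$ be the map of the $i$-th variable alone $$z\mapsto z-G_i(x_1,\dots,x_{i-1},z,x_{i+1},\dots,x_k).$$ Let $\deg$ denote the Leray–Schauder degree. (a) Suppose that, for every $i$, $x_i-G_i(x_1,\dots,x_k)\neq p_i$ whenever $x_i\in\partial\Omega_i$ and $x_j\in\Omega_j$ for all $j\ne i$. Then for every $i$ and every $\mathbf x\in\mathbf\Omega$ the degree $\deg((I-G_i)^{\mathbf x},\Omega_i,p_i)$ is well defined, and it does not depend on $\mathbf x\in\mathbf\Omega$. (b) Suppose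 moreover that, for every $i$, $x_i-G_i(x_1,\dots,x_k)\neq p_i$ whenever $x_i\in\partial\Omega_i$ and $x_j\in\overline{\Omega_j}$ for all $j\neq i$. Then $\deg(I-\mathbf G,\mathbf\Omega,\mathbf p)$ is well defined, and for every $\mathbf x\in\mathbf\Omega$ $$\deg(I-\mathbf G,\mathbf\Omega,\mathbf p)=\prod_{i=1}^k\deg\big((I-G_i)^{\mathbf x},\Omega_i,p_i\big).$$ -/

import Mathlib

open scoped ContDiff

/-- `T` is a (not necessarily linear) compact operator on the set `A`: it is continuous on `A` and
maps bounded subsets of `A` to relatively compact sets. -/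
def IsCompactMapOn {X Y : Type*} [NormedAddCommGroup X] [NormedAddCommGroup Y]
    (T : X → Y) (A : Set X) : Prop :=
  ContinuousOn T A ∧
    ∀ B ⊆ A, Bornology.IsBounded B → IsCompact (closure (T '' B))

/-- `p` is a regular value of the restriction of `g` to `Ω` (source and target have the same
finite dimension). -/
def IsRegularValueOn {V : Type*} [NormedAddCommGroup V] [NormedSpace ℝ V]
    (g : V → V) (Ω : Set V) (p : V) : Prop :=
  ∀ x ∈ Ω, g x = p → (fderiv ℝ g x).det ≠ 0

/-- The sum, over the solutions `x ∈ Ω` of `g x = p`, of the sign of the Jacobian determinant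
of `g` at `x`. -/
noncomputable def signedCount {V : Type*} [NormedAddCommGroup V] [NormedSpace ℝ V]
    (g : V → V) (Ω : Set V) (p : V) : ℤ :=
  ∑ᶠ x ∈ {x | x ∈ Ω ∧ g x = p}, (SignType.sign (fderiv ℝ g x).det : ℤ)

/-- `d` is the Brouwer degree `deg(f, Ω, p)`, where `V` is a finite-dimensional real normed space,
`Ω ⊆ V` is open and bounded, `f` is continuous on `closure Ω` and `p ∉ f(∂Ω)`: every smooth map
which is uniformly close enough to `f` on `closure Ω` and which has `p` as a regular value takes
the value `p` exactly `d` times in `Ω`, counted with the signs of the Jacobian determinant. -/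
def IsBrouwerDegree {V : Type*} [NormedAddCommGroup V] [NormedSpace ℝ V]
    (f : V → V) (Ω : Set V) (p : V) (d : ℤ) : Prop :=
  ∃ ε : ℝ, 0 < ε ∧ ∀ g : V → V, ContDiff ℝ ∞ g →
    (∀ x ∈ closure Ω, ‖g x - f x‖ < ε) → IsRegularValueOn g Ω p → signedCount g Ω p = d

/-- `d` is the Leray–Schauder degree `deg(S, Ω, p)`, where `E` is a real Banach space, `Ω ⊆ E` is
open and bounded, `S = I - T` with `T` compact on `closure Ω`, and `p ∉ S(∂Ω)`: for every
finite-dimensional subspace `V` containing `p` and every continuous `T' : closure Ω → V` such that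
`I - T'` is uniformly close enough to `S`, the integer `d` is the Brouwer degree
`deg((I - T')|_V, Ω ∩ V, p)`. -/
def IsLeraySchauderDegree {E : Type*} [NormedAddCommGroup E] [NormedSpace ℝ E]
    (S : E → E) (Ω : Set E) (p : E) (d : ℤ) : Prop :=
  ∃ ε : ℝ, 0 < ε ∧ ∀ (V : Submodule ℝ E) (_ : FiniteDimensional ℝ V) (hp : p ∈ V) (T' : E → V),
    ContinuousOn T' (closure Ω) →
    (∀ x ∈ closure Ω, ‖(x - (T' x : E)) - S x‖ < ε) →
    IsBrouwerDegree (fun v : V => v - T' (v : E)) {v : V | (v : E) ∈ Ω} ⟨p, hp⟩ d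

/-- The Leray–Schauder degree `deg(S, Ω, p)` as an integer (meaningful when there is exactly one
integer satisfying `IsLeraySchauderDegree S Ω p`). -/
noncomputable def leraySchauderDegree {E : Type*} [NormedAddCommGroup E] [NormedSpace ℝ E]
    (S : E → E) (Ω : Set E) (p : E) : ℤ :=
  Classical.epsilon (IsLeraySchauderDegree S Ω p)

/-- The `i`-th component `I - G_i` with all variables but the `i`-th one frozen at those of `x`,
as a map of the `i`-th variable. -/
def frozenComponent {k : ℕ} {E : Fin k → Type*} [∀ i, NormedAddCommGroup (E i)]
    (G : ∀ i, (∀ j, E j) → E i) (i : Fin k) (x : ∀ j, E j) : E i → E i :=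
  fun z => z - G i (Function.update x i z)

open scoped Topology
open MeasureTheory

/-! For (a), the frozen variables are parameters ranging over the product of the `Ω i`, which is
connected because each factor is contractible. The boundary condition on the open pieces says that
no zero reaches `∂Ω i` for any parameter, so homotopy invariance makes the degree constant
(`leraySchauderDegree_eq_of_isPreconnected`).

For (b), the variables other than the `a`-th inside `G a` are deformed to a fixed point `y` by
contractions of the `Ω j`. Once this is done for every `a`, the map is a product map, and the degree
of a product map is the product of the degrees (`leraySchauderDegree_pi`). Part (a) then replaces
`y` by any `x`. The difficulty is that the contractions live on the open sets and need not extend to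
their closures, so the deformation is not a homotopy on the closed product. Its zeros, over all
times, nevertheless form a compact subset of time × open product: at a limit of zeros the undeformed
equations pass to the limit and force the coordinates `j ≠ a` into `Ω j`; there the contractions are
continuous, so equation `a` passes to the limit too and puts the last coordinate in `Ω a`. Excision
to a neighbourhood of these zeros, whose closure stays in the open product, allows homotopy
invariance to be applied (`IsAdmissibleFamily.leraySchauderDegree_freeze`).

The degree theory itself is built from the definitions. For smooth maps with regular values, the
signed count of solutions is the integral of `φ (g x) * det Dg`, with `φ` a bump at `p` of integral
one; its derivative along a segment of maps is the integral of a divergence, since the cofactors of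
a Jacobian matrix are divergence free. Smooth approximation and Sard's theorem extend this to
continuous maps. The identity `det (1 - A B) = det (1 - B A)` shows that enlarging the
finite-dimensional subspace does not change the degree, and Schauder approximation gives the
Leray–Schauder degree. -/

/-! ### Derivatives of the determinant and of the adjugate. -/

theorem Matrix.det_updateRow_eq_sum_adjugate {ι R : Type*} [Fintype ι] [DecidableEq ι] [CommRing R]
    (M : Matrix ι ι R) (i : ι) (v : ι → R) :
    (M.updateRow i v).det = ∑ j, M.adjugate j i * v j := by
  rw [← Matrix.cramer_transpose_apply, Matrix.cramer_eq_adjugate_mulVec,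
    ← Matrix.adjugate_transpose]
  rfl

theorem HasFDerivAt.matrix_det {ι F : Type*} [Fintype ι] [DecidableEq ι] [NormedAddCommGroup F]
    [NormedSpace ℝ F] {M : F → Matrix ι ι ℝ} {N : ι → ι → F →L[ℝ] ℝ} {x : F}
    (h : ∀ i j, HasFDerivAt (fun y => M y i j) (N i j) x) :
    HasFDerivAt (fun y => (M y).det) (∑ i, ∑ j, (M x).adjugate j i • N i j) x := by
  let f : ContinuousMultilinearMap ℝ (fun _ : ι => ι → ℝ) ℝ :=
    { (Matrix.detRowAlternating (R := ℝ) (n := ι)).toMultilinearMap with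
      cont := by
        change Continuous fun A : ι → ι → ℝ => Matrix.det A
        exact Continuous.matrix_det (A := fun A : ι → ι → ℝ => (A : Matrix ι ι ℝ)) continuous_id }
  have hM : HasFDerivAt (fun y => (fun i j => M y i j : ι → ι → ℝ))
      (ContinuousLinearMap.pi fun i => ContinuousLinearMap.pi fun j => N i j) x := by
    rw [hasFDerivAt_pi']
    intro i
    rw [hasFDerivAt_pi']
    intro j
    exact h i j
  have := (f.hasFDerivAt (fun i j => M x i j)).comp x hM
  refine this.congr_fderiv ?_
  ext v
  simp only [ContinuousLinearMap.comp_apply, ContinuousMultilinearMap.linearDeriv_apply]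
  simp only [_root_.sum_apply, _root_.smul_apply]
  refine Finset.sum_congr rfl fun i _ => ?_
  exact Matrix.det_updateRow_eq_sum_adjugate (M x) i (fun j => N i j v)

/-- The derivative of the adjugate at `A` in the direction `B`. -/
noncomputable def Matrix.adjugateDeriv {ι : Type*} [Fintype ι] [DecidableEq ι]
    (A B : Matrix ι ι ℝ) : Matrix ι ι ℝ :=
  fun j i => ∑ a, ∑ b, (A.updateRow i (Pi.single j 1)).adjugate b a * (if a = i then 0 else B a b)

theorem HasFDerivAt.matrix_adjugate {ι F : Type*} [Fintype ι] [DecidableEq ι]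
    [NormedAddCommGroup F] [NormedSpace ℝ F] {M : F → Matrix ι ι ℝ} {N : ι → ι → F →L[ℝ] ℝ} {x : F}
    (h : ∀ i j, HasFDerivAt (fun y => M y i j) (N i j) x) (j i : ι) :
    ∃ L : F →L[ℝ] ℝ, HasFDerivAt (fun y => (M y).adjugate j i) L x ∧
      ∀ v, L v = (M x).adjugateDeriv (fun a b => N a b v) j i := by
  have h' : ∀ a b, HasFDerivAt (fun y => (M y).updateRow i (Pi.single j 1) a b)
      (if a = i then 0 else N a b) x := by
    intro a b
    by_cases hai : a = i
    · subst hai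
      simpa using hasFDerivAt_const (𝕜 := ℝ) _ x
    · simpa [Matrix.updateRow_apply, hai] using h a b
  simp only [Matrix.adjugate_apply (M _)]
  refine ⟨_, HasFDerivAt.matrix_det h', fun v => ?_⟩
  simp only [_root_.sum_apply, _root_.smul_apply, Matrix.adjugateDeriv, smul_eq_mul]
  refine Finset.sum_congr rfl fun a _ => Finset.sum_congr rfl fun b _ => ?_
  split_ifs <;> simp

/-- This is the derivative at `s = 0` of `M * adj M = det M • 1` along `M = A + s • B`. -/
theorem Matrix.adjugateDeriv_mul {ι : Type*} [Fintype ι] [DecidableEq ι] (A B : Matrix ι ι ℝ) :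
    A * A.adjugateDeriv B + B * A.adjugate = (A.adjugate * B).trace • (1 : Matrix ι ι ℝ) := by
  have hM : ∀ i j, HasFDerivAt (fun s : ℝ => (A + s • B) i j)
      ((1 : ℝ →L[ℝ] ℝ).smulRight (B i j)) 0 := by
    intro i j
    simp only [Matrix.add_apply, Matrix.smul_apply, smul_eq_mul]
    have := ((hasFDerivAt_id (𝕜 := ℝ) (0 : ℝ)).mul_const (B i j)).const_add (A i j)
    refine this.congr_fderiv ?_
    ext
    simp
  choose L hL hLv using HasFDerivAt.matrix_adjugate hM
  have hdet := HasFDerivAt.matrix_det hM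
  ext k i
  have hp : ∀ l, HasFDerivAt (fun s : ℝ => (A + s • B) k l * (A + s • B).adjugate l i)
      ((A + (0 : ℝ) • B) k l • L l i +
        (A + (0 : ℝ) • B).adjugate l i • (1 : ℝ →L[ℝ] ℝ).smulRight (B k l)) 0 := fun l =>
    (hM k l).mul (hL l i)
  have h1 := HasFDerivAt.fun_sum (u := Finset.univ) fun l _ => hp l
  have h2 := hdet.mul_const ((1 : Matrix ι ι ℝ) k i)
  have he : (fun s : ℝ => (A + s • B).det * (1 : Matrix ι ι ℝ) k i) =
      fun s : ℝ => ∑ l, (A + s • B) k l * (A + s • B).adjugate l i := by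
    funext s
    have := congrFun (congrFun (Matrix.mul_adjugate (A + s • B)) k) i
    simpa [Matrix.mul_apply] using this.symm
  rw [he] at h2
  have h3 := congrArg (fun L : ℝ →L[ℝ] ℝ => L 1) (h1.unique h2)
  simp only [_root_.sum_apply, _root_.smul_apply, _root_.add_apply, hLv,
    ContinuousLinearMap.smulRight_apply, zero_smul, add_zero, smul_eq_mul,
    one_apply_eq_self, one_mul] at h3
  simp only [Matrix.add_apply, Matrix.mul_apply, Matrix.smul_apply, Matrix.trace, Matrix.diag,
    smul_eq_mul]
  rw [← Finset.sum_add_distrib]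
  refine (Finset.sum_congr rfl fun l _ => ?_).trans (h3.trans ?_)
  · ring
  · rw [mul_comm, Finset.sum_comm]

/-- Multiplying `adjugateDeriv_mul` by the adjugate gives `det A • D = tr (adj A * B) • adj A - adj
A * B * adj A`. After summation the symmetry of `N`, which in the application is that of second
derivatives, makes the two terms on the right equal. -/
theorem Matrix.sum_adjugateDeriv_of_det_ne_zero {ι : Type*} [Fintype ι] [DecidableEq ι]
    {A : Matrix ι ι ℝ} (hA : A.det ≠ 0) {N : ι → Matrix ι ι ℝ}
    (hN : ∀ j a b, N j a b = N b a j) (i : ι) :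
    ∑ j, A.adjugateDeriv (N j) j i = 0 := by
  have key : ∀ j, A.det * A.adjugateDeriv (N j) j i =
      (A.adjugate * N j).trace * A.adjugate j i - (A.adjugate * N j * A.adjugate) j i := by
    intro j
    have h := congrArg (fun X => (A.adjugate * X) j i) (Matrix.adjugateDeriv_mul A (N j))
    simp only [Matrix.mul_add, ← Matrix.mul_assoc, Matrix.adjugate_mul, Matrix.add_apply,
      Matrix.smul_mul, Matrix.one_mul, Matrix.mul_smul, Matrix.mul_one, Matrix.smul_apply,
      smul_eq_mul] at h
    linarith
  have h2 : A.det * ∑ j, A.adjugateDeriv (N j) j i = 0 := by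
    rw [Finset.mul_sum, Finset.sum_congr rfl fun j _ => key j, Finset.sum_sub_distrib, sub_eq_zero]
    simp only [Matrix.trace, Matrix.diag, Matrix.mul_apply, Finset.sum_mul]
    conv_rhs => rw [Finset.sum_comm]
    refine Finset.sum_congr rfl fun j _ => Finset.sum_congr rfl fun a _ =>
      Finset.sum_congr rfl fun b _ => ?_
    rw [hN j b a]
  exact (mul_eq_zero.mp h2).resolve_left hA

/-- The invertible case extends by continuity, as `A + ε • 1` is invertible for all small `ε ≠ 0`.
-/
theorem Matrix.sum_adjugateDeriv {ι : Type*} [Fintype ι] [DecidableEq ι]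
    (A : Matrix ι ι ℝ) {N : ι → Matrix ι ι ℝ}
    (hN : ∀ j a b, N j a b = N b a j) (i : ι) :
    ∑ j, A.adjugateDeriv (N j) j i = 0 := by
  let f : ℝ → ℝ := fun ε => ∑ j, (A + ε • (1 : Matrix ι ι ℝ)).adjugateDeriv (N j) j i
  have hf : Continuous f := by
    unfold f Matrix.adjugateDeriv
    refine continuous_finsetSum _ fun j _ => continuous_finsetSum _ fun a _ =>
      continuous_finsetSum _ fun b _ => Continuous.mul ?_ continuous_const
    refine Continuous.matrix_elem (Continuous.matrix_adjugate ?_) _ _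
    refine Continuous.matrix_updateRow _ ?_ continuous_const
    fun_prop
  have hdet : ∀ᶠ ε in 𝓝[≠] (0 : ℝ), (A + ε • (1 : Matrix ι ι ℝ)).det ≠ 0 := by
    -- As a function of `ε` the determinant is a monic polynomial, so it has finitely many zeros.
    have h : ∀ ε : ℝ, (A + ε • (1 : Matrix ι ι ℝ)).det = (-A).charpoly.eval ε := fun ε => by
      rw [Matrix.eval_charpoly, sub_neg_eq_add, add_comm, Matrix.smul_one_eq_diagonal]
      rfl
    have hfin := (-A).charpoly.roots.toFinset.finite_toSet
    filter_upwards [(hfin.subset Set.sdiff_subset :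
      (((-A).charpoly.roots.toFinset : Set ℝ) \ {0}).Finite).isClosed.isOpen_compl.mem_nhds
        (by simp) |> mem_nhdsWithin_of_mem_nhds, self_mem_nhdsWithin] with ε h1 h2 h3
    refine h1 ⟨?_, h2⟩
    rw [h] at h3
    simpa [Polynomial.mem_roots (-A).charpoly_monic.ne_zero] using h3
  have h0 : ∀ᶠ ε in 𝓝[≠] (0 : ℝ), f ε = 0 :=
    hdet.mono fun ε h => Matrix.sum_adjugateDeriv_of_det_ne_zero h hN i
  have h1 : Filter.Tendsto f (𝓝[≠] 0) (𝓝 (f 0)) := hf.continuousAt.tendsto.mono_left inf_le_left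
  have h2 : Filter.Tendsto f (𝓝[≠] 0) (𝓝 0) := tendsto_const_nhds.congr' (h0.mono fun _ h => h.symm)
  simpa [f] using tendsto_nhds_unique h1 h2

/-! ### Two facts about integrals: divergences and parameters. -/

/-- Integration by parts against the constant function `1`. -/
theorem integral_fderiv_apply_eq_zero {E : Type*} [NormedAddCommGroup E] [NormedSpace ℝ E]
    [FiniteDimensional ℝ E] [MeasurableSpace E] [BorelSpace E] (μ : Measure E) [μ.IsAddHaarMeasure]
    {f : E → ℝ} (hf : ContDiff ℝ 1 f) (hc : HasCompactSupport f) (v : E) :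
    ∫ x, fderiv ℝ f x v ∂μ = 0 := by
  have hcont : Continuous fun x => fderiv ℝ f x v :=
    (hf.continuous_fderiv one_ne_zero).clm_apply continuous_const
  have hint : Integrable (fun x => fderiv ℝ f x v) μ :=
    hcont.integrable_of_hasCompactSupport (hc.fderiv_apply ℝ v)
  have := integral_mul_fderiv_eq_neg_fderiv_mul_of_integrable (μ := μ) (f := fun _ : E => (1 : ℝ))
    (g := f) (v := v) (by simp) (by simpa using hint)
    (by simpa using hf.continuous.integrable_of_hasCompactSupport hc)
    (fun _ _ => differentiableAt_const _) (fun x _ => hf.differentiable one_ne_zero x)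
  simpa using this

theorem hasDerivAt_integral_of_continuous_of_compact {E : Type*} [TopologicalSpace E] [T2Space E]
    [MeasurableSpace E] [OpensMeasurableSpace E] [SecondCountableTopology E] (μ : Measure E)
    [IsFiniteMeasureOnCompacts μ]
    {F F' : ℝ → E → ℝ} {K : Set E} (hK : IsCompact K) (hF : Continuous (Function.uncurry F))
    (hF' : Continuous (Function.uncurry F')) (hFK : ∀ t, ∀ x ∉ K, F t x = 0)
    (hd : ∀ t x, HasDerivAt (fun s => F s x) (F' t x) t) (t : ℝ) :
    HasDerivAt (fun s => ∫ x, F s x ∂μ) (∫ x, F' t x ∂μ) t := by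
  have hFK' : ∀ t, ∀ x ∉ K, F' t x = 0 := fun t x hx =>
    (hd t x).unique (by simpa [hFK _ x hx] using hasDerivAt_const t (0 : ℝ))
  obtain ⟨C, hC⟩ := ((isCompact_Icc (a := t - 1) (b := t + 1)).prod hK).exists_bound_of_continuousOn
    hF'.continuousOn
  have hFt : ∀ s, Continuous (F s) := fun s => hF.comp (by fun_prop : Continuous fun x => (s, x))
  have hFt' : ∀ s, Continuous (F' s) := fun s => hF'.comp (by fun_prop : Continuous fun x => (s, x))
  refine (hasDerivAt_integral_of_dominated_loc_of_deriv_le (μ := μ) (F := F) (F' := F')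
    (bound := K.indicator fun _ => C) (s := Set.Icc (t - 1) (t + 1))
    (Icc_mem_nhds (by linarith) (by linarith)) ?_ ?_ ?_ ?_ ?_ ?_).2
  · exact Filter.Eventually.of_forall fun s => (hFt s).aestronglyMeasurable
  · exact (hFt t).integrable_of_hasCompactSupport (HasCompactSupport.intro hK (hFK t))
  · exact (hFt' t).aestronglyMeasurable
  · refine Filter.Eventually.of_forall fun x s hs => ?_
    by_cases hx : x ∈ K
    · simpa [hx] using hC (s, x) ⟨hs, hx⟩
    · simp [hx, hFK' s x hx]
  · exact (integrable_indicator_iff hK.measurableSet).2 (integrableOn_const hK.measure_ne_top)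
  · exact Filter.Eventually.of_forall fun x s _ => hd s x

/-! ### Invariance of the degree integral along a segment of smooth maps. -/

section Jacobian
variable {ι : Type*} [Fintype ι] [DecidableEq ι]

/-- The Jacobian matrix of a map of `ι → ℝ` to itself. -/
noncomputable def jacobianMatrix (u : (ι → ℝ) → ι → ℝ) (x : ι → ℝ) : Matrix ι ι ℝ :=
  LinearMap.toMatrix' (fderiv ℝ u x : (ι → ℝ) →ₗ[ℝ] ι → ℝ)

theorem jacobianMatrix_apply (u : (ι → ℝ) → ι → ℝ) (x : ι → ℝ) (i j : ι) :
    jacobianMatrix u x i j = fderiv ℝ u x (Pi.single j 1) i := by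
  simp [jacobianMatrix, LinearMap.toMatrix'_apply]

theorem jacobianMatrix_mulVec (u : (ι → ℝ) → ι → ℝ) (x v : ι → ℝ) :
    (jacobianMatrix u x).mulVec v = fderiv ℝ u x v := by
  simp [jacobianMatrix, LinearMap.toMatrix'_mulVec]

theorem det_jacobianMatrix (u : (ι → ℝ) → ι → ℝ) (x : ι → ℝ) :
    (jacobianMatrix u x).det = (fderiv ℝ u x).det := by
  rw [ContinuousLinearMap.det, ← LinearMap.det_toMatrix', jacobianMatrix]

theorem jacobianMatrix_add_smul {u w : (ι → ℝ) → ι → ℝ} (hu : ContDiff ℝ ∞ u) (hw : ContDiff ℝ ∞ w)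
    (t : ℝ) (x : ι → ℝ) :
    jacobianMatrix (fun y => u y + t • w y) x = jacobianMatrix u x + t • jacobianMatrix w x := by
  ext i j
  have h1 := hu.differentiable (by simp) x
  have h2 := hw.differentiable (by simp) x
  have h3 : HasFDerivAt (fun y => u y + t • w y) (fderiv ℝ u x + t • fderiv ℝ w x) x :=
    h1.hasFDerivAt.add (h2.hasFDerivAt.const_smul t)
  simp [jacobianMatrix_apply, h3.fderiv]

theorem continuous_jacobianMatrix {u : (ι → ℝ) → ι → ℝ} (hu : ContDiff ℝ ∞ u) :
    Continuous (jacobianMatrix u) := by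
  have := hu.continuous_fderiv (by simp)
  refine continuous_matrix fun i j => ?_
  simp only [jacobianMatrix_apply]
  exact (continuous_apply i).comp (this.clm_apply continuous_const)

theorem contDiff_jacobianMatrix_apply {u : (ι → ℝ) → ι → ℝ} (hu : ContDiff ℝ ∞ u) (i j : ι) :
    ContDiff ℝ ∞ fun x => jacobianMatrix u x i j := by
  have h : ContDiff ℝ ∞ (fderiv ℝ u) := hu.fderiv_right (by simp)
  simp only [jacobianMatrix_apply]
  exact contDiff_pi.1 (h.clm_apply contDiff_const) i

theorem contDiff_adjugate_jacobianMatrix_apply {u : (ι → ℝ) → ι → ℝ} (hu : ContDiff ℝ ∞ u)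
    (i j : ι) : ContDiff ℝ ∞ fun x => (jacobianMatrix u x).adjugate i j := by
  simp only [Matrix.adjugate_apply, Matrix.det_apply]
  refine ContDiff.sum fun σ _ => ContDiff.const_smul _ (contDiff_prod fun k _ => ?_)
  by_cases h : σ k = j
  · simpa [Matrix.updateRow_apply, h] using contDiff_const
  · simpa [Matrix.updateRow_apply, h] using contDiff_jacobianMatrix_apply hu (σ k) k

/-- The rows of the adjugate of a Jacobian matrix are divergence free. -/
theorem sum_fderiv_adjugate_jacobianMatrix {u : (ι → ℝ) → ι → ℝ} (hu : ContDiff ℝ ∞ u)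
    (x : ι → ℝ) (i : ι) :
    ∑ j, fderiv ℝ (fun y => (jacobianMatrix u y).adjugate j i) x (Pi.single j 1) = 0 := by
  have hJ : ∀ a b, HasFDerivAt (fun y => jacobianMatrix u y a b)
      (fderiv ℝ (fun y => jacobianMatrix u y a b) x) x := fun a b =>
    ((contDiff_jacobianMatrix_apply hu a b).differentiable (by simp) x).hasFDerivAt
  choose L hL hLv using HasFDerivAt.matrix_adjugate hJ
  simp only [fun j => (hL j i).fderiv, hLv]
  refine Matrix.sum_adjugateDeriv _ (fun j a b => ?_) i
  have h2 : ∀ b v, fderiv ℝ (fun y => jacobianMatrix u y a b) x v =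
      fderiv ℝ (fderiv ℝ u) x v (Pi.single b 1) a := by
    intro b v
    have hd : DifferentiableAt ℝ (fderiv ℝ u) x :=
      (hu.fderiv_right (m := ∞) (by simp)).differentiable (by simp) x
    have h3 : HasFDerivAt (fun y => fderiv ℝ u y (Pi.single b 1)) _ x :=
      hd.hasFDerivAt.clm_apply (hasFDerivAt_const (Pi.single b (1 : ℝ) : ι → ℝ) x)
    replace h3 := hasFDerivAt_pi'.1 h3 a
    simp only [jacobianMatrix_apply]
    rw [h3.fderiv]
    simp
  rw [h2, h2]
  have : IsSymmSndFDerivAt ℝ u x := hu.contDiffAt.isSymmSndFDerivAt 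
    (by rw [minSmoothness_of_isRCLikeNormedField]; exact WithTop.coe_le_coe.2 le_top)
  rw [this.eq]

/-- The right-hand side is `χ` times the `t`-derivative at `0` of `φ (u + t w) * det D(u + t w)`,
here written as a divergence. The cofactors contribute nothing when differentiated, and `hx` removes
the term with the derivative of `χ`. -/
theorem sum_fderiv_mul_adjugate_jacobianMatrix {u w : (ι → ℝ) → ι → ℝ} {φ χ : (ι → ℝ) → ℝ}
    (hu : ContDiff ℝ ∞ u) (hw : ContDiff ℝ ∞ w) (hφ : ContDiff ℝ ∞ φ) (hχ : ContDiff ℝ ∞ χ)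
    {x : ι → ℝ} (hx : fderiv ℝ χ x = 0 ∨ φ (u x) = 0) :
    ∑ j, fderiv ℝ (fun y => χ y * φ (u y) * ∑ i, (jacobianMatrix u y).adjugate j i * w y i) x
        (Pi.single j 1) =
      χ x * (fderiv ℝ φ (u x) (w x) * (jacobianMatrix u x).det +
        φ (u x) * ∑ i, ∑ j, (jacobianMatrix u x).adjugate j i * jacobianMatrix w x i j) := by
  have dχ := (hχ.differentiable (by simp) x).hasFDerivAt
  have du := (hu.differentiable (by simp) x).hasFDerivAt
  have dφ := (hφ.differentiable (by simp) (u x)).hasFDerivAt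
  have dw := (hw.differentiable (by simp) x).hasFDerivAt
  have dwi : ∀ i, HasFDerivAt (fun y => w y i) ((ContinuousLinearMap.proj i).comp (fderiv ℝ w x)) x :=
    fun i => hasFDerivAt_pi'.1 dw i
  have dA : ∀ j i, HasFDerivAt (fun y => (jacobianMatrix u y).adjugate j i)
      (fderiv ℝ (fun y => (jacobianMatrix u y).adjugate j i) x) x := fun j i =>
    ((contDiff_adjugate_jacobianMatrix_apply hu j i).differentiable (by simp) x).hasFDerivAt
  have hX : ∀ j, fderiv ℝ
      (fun y => χ y * φ (u y) * ∑ i, (jacobianMatrix u y).adjugate j i * w y i) x (Pi.single j 1) =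
      χ x * φ (u x) * (∑ i, ((jacobianMatrix u x).adjugate j i * jacobianMatrix w x i j +
        w x i * fderiv ℝ (fun y => (jacobianMatrix u y).adjugate j i) x (Pi.single j 1))) +
      χ x * fderiv ℝ φ (u x) (fderiv ℝ u x (Pi.single j 1)) *
        ∑ i, (jacobianMatrix u x).adjugate j i * w x i := by
    intro j
    have hs : HasFDerivAt (fun y => ∑ i, (jacobianMatrix u y).adjugate j i * w y i) _ x :=
      HasFDerivAt.fun_sum (u := Finset.univ) fun i _ => (dA j i).mul (dwi i)
    have h1 : HasFDerivAt
        (fun y => χ y * φ (u y) * ∑ i, (jacobianMatrix u y).adjugate j i * w y i) _ x :=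
      (dχ.mul (dφ.comp x du)).mul hs
    have h2 : φ (u x) * fderiv ℝ χ x (Pi.single j 1) = 0 := by
      rcases hx with h | h <;> simp [h]
    rw [h1.fderiv]
    simp only [_root_.add_apply, _root_.smul_apply, _root_.sum_apply, smul_eq_mul,
      ContinuousLinearMap.comp_apply, Function.comp_apply, ContinuousLinearMap.proj_apply, h2, Pi.mul_apply]
    simp only [jacobianMatrix_apply]
    ring
  have hdiv : ∑ j, ∑ i, w x i *
      fderiv ℝ (fun y => (jacobianMatrix u y).adjugate j i) x (Pi.single j 1) = 0 := by
    rw [Finset.sum_comm]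
    simp only [← Finset.mul_sum, sum_fderiv_adjugate_jacobianMatrix hu, mul_zero,
      Finset.sum_const_zero]
  have hmain : ∑ j, fderiv ℝ φ (u x) (fderiv ℝ u x (Pi.single j 1)) *
      ∑ i, (jacobianMatrix u x).adjugate j i * w x i =
      fderiv ℝ φ (u x) (w x) * (jacobianMatrix u x).det := by
    have h1 : ∀ v : ι → ℝ, ∑ j, fderiv ℝ φ (u x) (fderiv ℝ u x (Pi.single j 1)) * v j =
        fderiv ℝ φ (u x) (fderiv ℝ u x v) := by
      intro v
      conv_rhs => rw [pi_eq_sum_univ' v]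
      simp [mul_comm]
    -- The chain rule meets the adjugate here: `Du * adj Du = det Du • 1` turns the derivative of `φ
    -- ∘ u` into `dφ (w)` times the Jacobian determinant.
    have h2 : fderiv ℝ u x ((jacobianMatrix u x).adjugate.mulVec (w x)) =
        (jacobianMatrix u x).det • w x := by
      rw [← jacobianMatrix_mulVec, Matrix.mulVec_mulVec, Matrix.mul_adjugate, Matrix.smul_mulVec,
        Matrix.one_mulVec]
    have h3 := h1 ((jacobianMatrix u x).adjugate.mulVec (w x))
    rw [h2] at h3
    simpa [Matrix.mulVec, dotProduct, mul_comm] using h3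
  rw [Finset.sum_congr rfl fun j _ => hX j, Finset.sum_add_distrib, ← Finset.mul_sum]
  simp only [mul_assoc, ← Finset.mul_sum, hmain, Finset.sum_add_distrib, hdiv, add_zero]
  conv_rhs => rw [Finset.sum_comm]
  ring

/-- Along `u + t • w` the `t`-derivative of the integral is the integral of a compactly supported
divergence, hence zero. The alternative in `h` says that `χ` is locally constant to first order
wherever `φ` sees the map. -/
theorem integral_comp_mul_det_jacobianMatrix_eq {u w : (ι → ℝ) → ι → ℝ} {φ χ : (ι → ℝ) → ℝ}
    (hu : ContDiff ℝ ∞ u) (hw : ContDiff ℝ ∞ w) (hφ : ContDiff ℝ ∞ φ) (hχ : ContDiff ℝ ∞ χ)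
    (hχc : HasCompactSupport χ)
    (h : ∀ t ∈ Set.Icc (0 : ℝ) 1, ∀ x, fderiv ℝ χ x = 0 ∨ φ (u x + t • w x) = 0) :
    ∫ x, χ x * (φ (u x) * (jacobianMatrix u x).det) =
      ∫ x, χ x * (φ (u x + w x) * (jacobianMatrix (fun y => u y + w y) x).det) := by
  let J : ℝ → (ι → ℝ) → Matrix ι ι ℝ := fun t x => jacobianMatrix u x + t • jacobianMatrix w x
  let F : ℝ → (ι → ℝ) → ℝ := fun t x => χ x * (φ (u x + t • w x) * (J t x).det)
  let F' : ℝ → (ι → ℝ) → ℝ := fun t x =>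
    χ x * (fderiv ℝ φ (u x + t • w x) (w x) * (J t x).det +
        φ (u x + t • w x) * ∑ i, ∑ j, (J t x).adjugate j i * jacobianMatrix w x i j)
  have hut : ∀ t : ℝ, ContDiff ℝ ∞ fun y => u y + t • w y := fun t => hu.add (hw.const_smul t)
  have cu : Continuous fun q : ℝ × (ι → ℝ) => u q.2 + q.1 • w q.2 := by
    have := hu.continuous
    have := hw.continuous
    fun_prop
  have cJ : Continuous fun q : ℝ × (ι → ℝ) => J q.1 q.2 := by
    have := continuous_jacobianMatrix hu
    have := continuous_jacobianMatrix hw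
    fun_prop
  have cF : Continuous (Function.uncurry F) :=
    (hχ.continuous.comp continuous_snd).mul ((hφ.continuous.comp cu).mul cJ.matrix_det)
  have cF' : Continuous (Function.uncurry F') := by
    refine (hχ.continuous.comp continuous_snd).mul (Continuous.add (Continuous.mul ?_ cJ.matrix_det)
      ((hφ.continuous.comp cu).mul (continuous_finsetSum _ fun i _ => continuous_finsetSum _
        fun j _ => (cJ.matrix_adjugate.matrix_elem j i).mul
          (((continuous_jacobianMatrix hw).comp continuous_snd).matrix_elem i j))))
    exact ((hφ.continuous_fderiv (by simp)).comp cu).clm_apply (hw.continuous.comp continuous_snd)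
  have hd : ∀ t x, HasDerivAt (fun s => F s x) (F' t x) t := by
    intro t x
    have hJ : ∀ i j, HasFDerivAt (fun s : ℝ => J s x i j)
        ((1 : ℝ →L[ℝ] ℝ).smulRight (jacobianMatrix w x i j)) t := by
      intro i j
      have := ((hasDerivAt_id t).mul_const (jacobianMatrix w x i j)).const_add (jacobianMatrix u x i j)
      refine (this.hasFDerivAt.congr_fderiv ?_)
      ext
      simp
    have h1 := (HasFDerivAt.matrix_det hJ).hasDerivAt
    have h2 : HasDerivAt (fun s : ℝ => u x + s • w x) (w x) t := by
      simpa using ((hasDerivAt_id t).smul_const (w x)).const_add (u x)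
    have h3 := ((hφ.differentiable (by simp) _).hasFDerivAt).comp_hasDerivAt t h2
    have h4 := (h3.mul h1).const_mul (χ x)
    refine h4.congr_deriv ?_
    simp [F', _root_.sum_apply]
  have hI := hasDerivAt_integral_of_continuous_of_compact volume hχc cF cF'
    (fun t x hx => by simp [F, image_eq_zero_of_notMem_tsupport hx]) hd
  have hzero : ∀ t ∈ Set.Icc (0 : ℝ) 1, ∫ x, F' t x = 0 := by
    intro t ht
    have hF' : ∀ x, F' t x = ∑ j, fderiv ℝ (fun y => χ y * φ (u y + t • w y) *
        ∑ i, (jacobianMatrix (fun z => u z + t • w z) y).adjugate j i * w y i) x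
        (Pi.single j 1) := by
      intro x
      rw [sum_fderiv_mul_adjugate_jacobianMatrix (hut t) hw hφ hχ (h t ht x),
        jacobianMatrix_add_smul hu hw]
    have hsm : ∀ j, ContDiff ℝ ∞ (fun y => χ y * φ (u y + t • w y) *
        ∑ i, (jacobianMatrix (fun z => u z + t • w z) y).adjugate j i * w y i) := fun j =>
      (hχ.mul (hφ.comp (hut t))).mul (ContDiff.sum fun i _ =>
        (contDiff_adjugate_jacobianMatrix_apply (hut t) j i).mul (contDiff_pi.1 hw i))
    have hsupp : ∀ j, HasCompactSupport (fun y => χ y * φ (u y + t • w y) *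
        ∑ i, (jacobianMatrix (fun z => u z + t • w z) y).adjugate j i * w y i) := fun j =>
      HasCompactSupport.mul_right (HasCompactSupport.mul_right hχc)
    simp only [hF']
    rw [integral_finsetSum]
    · exact Finset.sum_eq_zero fun j _ =>
        integral_fderiv_apply_eq_zero volume ((hsm j).of_le (by simp)) (hsupp j) _
    · intro j _
      exact (((hsm j).continuous_fderiv (by simp)).clm_apply
        continuous_const).integrable_of_hasCompactSupport ((hsupp j).fderiv_apply ℝ _)
  have hconst := constant_of_has_deriv_right_zero (f := fun s => ∫ x, F s x) (a := 0) (b := 1)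
    (fun t _ => (hI t).continuousAt.continuousWithinAt)
    (fun t ht => by
      simpa [hzero t ⟨ht.1, ht.2.le⟩] using (hI t).hasDerivWithinAt (s := Set.Ici t)) 1 (by simp)
  have hj : ∀ x, jacobianMatrix (fun y => u y + w y) x = J 1 x := fun x => by
    simpa [J] using jacobianMatrix_add_smul hu hw 1 x
  simpa [F, J, hj] using hconst.symm

end Jacobian

/-! ### The signed count as an integral. -/

section Count
variable {V : Type*} [NormedAddCommGroup V] [NormedSpace ℝ V] [FiniteDimensional ℝ V]

theorem hasStrictFDerivAt_equiv_of_det_ne_zero {g : V → V} (hg : ContDiff ℝ ∞ g) {x : V}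
    (hx : (fderiv ℝ g x).det ≠ 0) :
    HasStrictFDerivAt g (((fderiv ℝ g x).toContinuousLinearEquivOfDetNeZero hx : V ≃L[ℝ] V) :
      V →L[ℝ] V) x := by
  have := hg.contDiffAt.hasStrictFDerivAt (x := x) (by simp)
  convert this using 1
  ext
  rfl

/-- Near a point where the derivative is invertible, a smooth map is injective and the sign of the
Jacobian determinant is constant. -/
theorem exists_nhds_injOn_sign_det_eq {g : V → V} (hg : ContDiff ℝ ∞ g) {x : V}
    (hx : (fderiv ℝ g x).det ≠ 0) :
    ∃ U ∈ 𝓝 x, Set.InjOn g U ∧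
      ∀ y ∈ U, SignType.sign (fderiv ℝ g y).det = SignType.sign (fderiv ℝ g x).det := by
  have := FiniteDimensional.complete ℝ V
  have hs := hasStrictFDerivAt_equiv_of_det_ne_zero hg hx
  have hdet : Continuous fun y => (fderiv ℝ g y).det :=
    ContinuousLinearMap.continuous_det.comp (hg.continuous_fderiv (by simp))
  refine ⟨(hs.toOpenPartialHomeomorph g).source ∩
    {y | SignType.sign (fderiv ℝ g y).det = SignType.sign (fderiv ℝ g x).det}, ?_, ?_, ?_⟩
  · refine Filter.inter_mem ((hs.toOpenPartialHomeomorph g).open_source.mem_nhds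
      hs.mem_toOpenPartialHomeomorph_source) ?_
    rcases lt_or_gt_of_ne hx with h | h
    · filter_upwards [hdet.continuousAt.eventually_lt continuousAt_const h] with y hy
      simp [sign_neg hy, sign_neg h]
    · filter_upwards [continuousAt_const.eventually_lt hdet.continuousAt h] with y hy
      simp [sign_pos hy, sign_pos h]
  · exact (hs.toOpenPartialHomeomorph g).injOn.mono Set.inter_subset_left
  · exact fun y hy => hy.2

/-- The preimages of a regular value not attained on the boundary form a finite set. -/
theorem IsRegularValueOn.finite_preimage {g : V → V} (hg : ContDiff ℝ ∞ g) {Ω : Set V}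
    (hb : Bornology.IsBounded Ω) {p : V} (hp : ∀ x ∈ closure Ω, g x = p → x ∈ Ω)
    (hreg : IsRegularValueOn g Ω p) : {x | x ∈ Ω ∧ g x = p}.Finite := by
  have := FiniteDimensional.proper ℝ V
  have hcomp : IsCompact {x | x ∈ Ω ∧ g x = p} := by
    have : {x | x ∈ Ω ∧ g x = p} = closure Ω ∩ g ⁻¹' {p} := by
      ext x
      exact ⟨fun h => ⟨subset_closure h.1, h.2⟩, fun h => ⟨hp x h.1 h.2, h.2⟩⟩
    rw [this]
    exact hb.isCompact_closure.inter_right (isClosed_singleton.preimage hg.continuous)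
  -- The solution set is compact, and each of its points has a neighbourhood containing no other
  -- solution.
  choose! U hU hinj _ using fun x (hx : x ∈ {x | x ∈ Ω ∧ g x = p}) =>
    exists_nhds_injOn_sign_det_eq hg (hreg x hx.1 hx.2)
  obtain ⟨t, ht, hcov⟩ := hcomp.elim_nhds_subcover U hU
  refine t.finite_toSet.subset fun y hy => ?_
  obtain ⟨x, hx, hyx⟩ := Set.mem_iUnion₂.1 (hcov hy)
  have : y = x := hinj x (ht x hx) hyx (mem_of_mem_nhds (hU x (ht x hx)))
    (hy.2.trans (ht x hx).2.symm)
  exact this ▸ hx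

variable [MeasurableSpace V] [BorelSpace V]

/-- Over a small ball at `p` the part of the preimage in `Ω` lies in disjoint sheets `W x`, one per
solution, on which `g` is injective with constant sign. Change of variables on each sheet yields
that sign times `∫ φ`. The radius `r1` makes every sheet cover the ball; `r2` leaves no preimage in
`Ω` outside the sheets. -/
theorem exists_integral_comp_mul_det_eq_signedCount (μ : Measure V) [μ.IsAddHaarMeasure]
    {g : V → V} (hg : ContDiff ℝ ∞ g) {Ω : Set V} (ho : IsOpen Ω)
    (hb : Bornology.IsBounded Ω) {p : V} (hp : ∀ x ∈ closure Ω, g x = p → x ∈ Ω)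
    (hreg : IsRegularValueOn g Ω p) :
    ∃ r > 0, ∀ φ χ : V → ℝ, Continuous φ → Function.support φ ⊆ Metric.ball p r →
      (∀ x ∈ Ω, g x ∈ Function.support φ → χ x = 1) → (∀ x ∉ Ω, χ x = 0) →
      ∫ x, χ x * (φ (g x) * (fderiv ℝ g x).det) ∂μ = signedCount g Ω p * ∫ x, φ x ∂μ := by
  have := FiniteDimensional.proper ℝ V
  have := FiniteDimensional.complete ℝ V
  have hfin := hreg.finite_preimage hg hb hp
  set S := {x | x ∈ Ω ∧ g x = p} with hS
  obtain ⟨D, hD, hDd⟩ := hfin.t2_separation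
  have hloc : ∀ x ∈ S, ∃ W : Set V, IsOpen W ∧ x ∈ W ∧ W ⊆ D x ∧ W ⊆ Ω ∧ Set.InjOn g W ∧
      ∀ y ∈ W, SignType.sign (fderiv ℝ g y).det = SignType.sign (fderiv ℝ g x).det := by
    intro x hx
    obtain ⟨U, hU, hinj, hsign⟩ := exists_nhds_injOn_sign_det_eq hg (hreg x hx.1 hx.2)
    obtain ⟨W, hWU, hWo, hxW⟩ := mem_nhds_iff.1
      (Filter.inter_mem hU (((hD x).2.inter ho).mem_nhds ⟨(hD x).1, hx.1⟩))
    exact ⟨W, hWo, hxW, fun y hy => (hWU hy).2.1, fun y hy => (hWU hy).2.2,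
      hinj.mono fun y hy => (hWU hy).1, fun y hy => hsign y (hWU hy).1⟩
  choose! W hWo hxW hWD hWΩ hinj hsign using hloc
  have hr1 : ∃ r1 > 0, ∀ x ∈ S, Metric.ball p r1 ⊆ g '' W x := by
    have : ∀ x ∈ S, g '' W x ∈ 𝓝 p := by
      intro x hx
      rw [← hx.2, ← (hasStrictFDerivAt_equiv_of_det_ne_zero hg
        (hreg x hx.1 hx.2)).map_nhds_eq_of_equiv]
      exact Filter.image_mem_map ((hWo x hx).mem_nhds (hxW x hx))
    have h2 : ⋂ x ∈ S, g '' W x ∈ 𝓝 p := (Filter.biInter_mem hfin).2 this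
    obtain ⟨r, hr, hsub⟩ := Metric.mem_nhds_iff.1 h2
    exact ⟨r, hr, fun x hx y hy => Set.mem_iInter₂.1 (hsub hy) x hx⟩
  obtain ⟨r1, hr1, hball⟩ := hr1
  have hr2 : ∃ r2 > 0, ∀ x ∈ Ω, g x ∈ Metric.ball p r2 → x ∈ ⋃ x ∈ S, W x := by
    have hK : IsCompact (closure Ω \ ⋃ x ∈ S, W x) :=
      hb.isCompact_closure.diff (isOpen_biUnion hWo)
    have hKp : p ∉ g '' (closure Ω \ ⋃ x ∈ S, W x) := by
      rintro ⟨x, hx, hxp⟩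
      have hxS : x ∈ S := ⟨hp x hx.1 hxp, hxp⟩
      exact hx.2 (Set.mem_biUnion hxS (hxW x hxS))
    obtain ⟨r, hr, hsub⟩ := Metric.mem_nhds_iff.1
      ((hK.image hg.continuous).isClosed.isOpen_compl.mem_nhds hKp)
    refine ⟨r, hr, fun x hx hgx => ?_⟩
    by_contra hcon
    exact hsub hgx ⟨x, ⟨subset_closure hx, hcon⟩, rfl⟩
  obtain ⟨r2, hr2, hcov⟩ := hr2
  refine ⟨min r1 r2, lt_min hr1 hr2, fun φ χ hφ hφs hχ1 hχ0 => ?_⟩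
  have hcont : Continuous fun x => φ (g x) * (fderiv ℝ g x).det :=
    (hφ.comp hg.continuous).mul
      (ContinuousLinearMap.continuous_det.comp (hg.continuous_fderiv (by simp)))
  have hstep : ∫ x, χ x * (φ (g x) * (fderiv ℝ g x).det) ∂μ =
      ∫ x in ⋃ x ∈ hfin.toFinset, W x, φ (g x) * (fderiv ℝ g x).det ∂μ := by
    rw [← integral_indicator (Finset.measurableSet_biUnion _ fun x hx =>
      (hWo x (hfin.mem_toFinset.1 hx)).measurableSet)]
    congr 1
    funext y
    by_cases hy : y ∈ ⋃ x ∈ hfin.toFinset, W x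
    · rw [Set.indicator_of_mem hy]
      obtain ⟨x, hx, hyx⟩ := Set.mem_iUnion₂.1 hy
      by_cases h0 : φ (g y) = 0
      · simp [h0]
      · rw [hχ1 y (hWΩ x (hfin.mem_toFinset.1 hx) hyx) h0, one_mul]
    · rw [Set.indicator_of_notMem hy]
      by_cases hyΩ : y ∈ Ω
      · by_cases h0 : φ (g y) = 0
        · simp [h0]
        · refine absurd ?_ hy
          simpa using hcov y hyΩ (Metric.ball_subset_ball (min_le_right _ _) (hφs h0))
      · simp [hχ0 y hyΩ]
  rw [hstep, integral_biUnion_finset]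
  · rw [signedCount, finsum_mem_eq_finite_toFinset_sum _ hfin, Int.cast_sum, Finset.sum_mul]
    refine Finset.sum_congr rfl fun x hx => ?_
    rw [hfin.mem_toFinset] at hx
    have h1 : ∫ y in g '' W x, φ y ∂μ = ∫ y, φ y ∂μ := by
      refine setIntegral_eq_integral_of_forall_compl_eq_zero fun y hy => ?_
      by_contra h0
      exact hy (hball x hx (Metric.ball_subset_ball (min_le_left _ _) (hφs h0)))
    rw [← h1, integral_image_eq_integral_abs_det_fderiv_smul μ (hWo x hx).measurableSet
      (fun y _ => (hg.differentiable (by simp) y).hasFDerivAt.hasFDerivWithinAt) (hinj x hx),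
      ← integral_const_mul]
    refine setIntegral_congr_fun (hWo x hx).measurableSet fun y hy => ?_
    have h2 : (fderiv ℝ g y).det =
        ((SignType.sign (fderiv ℝ g x).det : ℤ) : ℝ) * |(fderiv ℝ g y).det| := by
      rw [← hsign x hx y hy]
      simp [SignType.intCast_cast, sign_mul_abs]
    simp only [smul_eq_mul]
    rw [← mul_assoc, ← h2, mul_comm]
  · intro x hx
    exact (hWo x (hfin.mem_toFinset.1 hx)).measurableSet
  · intro x hx y hy hxy
    have hx' : x ∈ S := by simpa using hx
    have hy' : y ∈ S := by simpa using hy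
    exact (hDd hx' hy' hxy).mono (hWD x hx') (hWD y hy')
  · intro x hx
    exact (hcont.continuousOn.integrableOn_compact hb.isCompact_closure).mono_set
      ((hWΩ x (hfin.mem_toFinset.1 hx)).trans subset_closure)

end Count

/-- Both counts, times the same positive `∫ φ`, are the integrals at the two ends of the segment.
The work lies in choosing one `φ` and one cutoff `χ` valid for all times. -/
theorem signedCount_eq_of_forall_segment_pi {ι : Type*} [Fintype ι] [DecidableEq ι]
    {u w : (ι → ℝ) → ι → ℝ} (hu : ContDiff ℝ ∞ u) (hw : ContDiff ℝ ∞ w) {Ω : Set (ι → ℝ)}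
    (ho : IsOpen Ω) (hb : Bornology.IsBounded Ω) {p : ι → ℝ}
    (h : ∀ t ∈ Set.Icc (0 : ℝ) 1, ∀ x ∈ closure Ω, u x + t • w x = p → x ∈ Ω)
    (hu' : IsRegularValueOn u Ω p) (hw' : IsRegularValueOn (fun x => u x + w x) Ω p) :
    signedCount u Ω p = signedCount (fun x => u x + w x) Ω p := by
  obtain ⟨r0, hr0, H0⟩ := exists_integral_comp_mul_det_eq_signedCount volume hu ho hb
    (fun x hx hxp => h 0 (by simp) x hx (by simpa using hxp)) hu'
  obtain ⟨r1, hr1, H1⟩ := exists_integral_comp_mul_det_eq_signedCount volume (hu.add hw) ho hb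
    (fun x hx hxp => h 1 (by simp) x hx (by simpa using hxp)) hw'
  have cu : Continuous fun q : ℝ × (ι → ℝ) => u q.2 + q.1 • w q.2 := by
    have := hu.continuous
    have := hw.continuous
    fun_prop
  obtain ⟨r2, hr2, H2⟩ : ∃ r2 > 0, ∀ t ∈ Set.Icc (0 : ℝ) 1, ∀ x ∈ closure Ω,
      u x + t • w x ∈ Metric.ball p r2 → x ∈ Ω := by
    have hK : IsCompact (Set.Icc (0 : ℝ) 1 ×ˢ (closure Ω \ Ω)) :=
      isCompact_Icc.prod (hb.isCompact_closure.diff ho)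
    have hKp : p ∉ (fun q : ℝ × (ι → ℝ) => u q.2 + q.1 • w q.2) ''
        (Set.Icc (0 : ℝ) 1 ×ˢ (closure Ω \ Ω)) := by
      rintro ⟨⟨t, x⟩, hx, hxp⟩
      exact hx.2.2 (h t hx.1 x hx.2.1 hxp)
    obtain ⟨r, hr, hsub⟩ := Metric.mem_nhds_iff.1
      ((hK.image cu).isClosed.isOpen_compl.mem_nhds hKp)
    refine ⟨r, hr, fun t ht x hx hgx => ?_⟩
    by_contra hcon
    exact hsub hgx ⟨(t, x), ⟨ht, hx, hcon⟩, rfl⟩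
  -- Half of the minimum, so that the closed `r`-ball still lies in all three open balls.
  set r := min r0 (min r1 r2) / 2 with hr
  have hmin : 0 < min r0 (min r1 r2) := lt_min hr0 (lt_min hr1 hr2)
  have hrpos : 0 < r := by positivity
  have hrlt : r < min r0 (min r1 r2) := by linarith
  -- All points of `closure Ω` sent into the closed ball at some time. The cutoff `χ` will be `1` on
  -- a neighbourhood of `K`, so its derivative vanishes there, while `φ` vanishes on the values
  -- taken in the rest of `Ω`.
  let K : Set (ι → ℝ) := Prod.snd '' ((Set.Icc (0 : ℝ) 1 ×ˢ closure Ω) ∩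
    (fun q : ℝ × (ι → ℝ) => u q.2 + q.1 • w q.2) ⁻¹' Metric.closedBall p r)
  have hK : IsCompact K := ((isCompact_Icc.prod hb.isCompact_closure).inter_right
    (Metric.isClosed_closedBall.preimage cu)).image continuous_snd
  have hKΩ : K ⊆ Ω := by
    rintro _ ⟨⟨t, x⟩, ⟨⟨ht, hx⟩, hq⟩, rfl⟩
    exact H2 t ht x hx (Metric.closedBall_subset_ball
      (hrlt.trans_le ((min_le_right _ _).trans (min_le_right _ _))) hq)
  obtain ⟨K1, hK1, hKK1, hK1Ω⟩ := exists_compact_between hK ho hKΩ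
  obtain ⟨K2, hK2, hK12, hK2Ω⟩ := exists_compact_between hK1 ho hK1Ω
  obtain ⟨χ, hχs, -, hχ0, hχ1⟩ := exists_contMDiff_zero_iff_one_iff_of_isClosed
    (modelWithCornersSelf ℝ (ι → ℝ)) (n := ⊤) (s := (interior K2)ᶜ) (t := K1)
    isOpen_interior.isClosed_compl hK1.isClosed
    (Set.disjoint_left.2 fun x hx hx' => hx (hK12 hx'))
  have hχs : ContDiff ℝ ∞ χ := hχs.contDiff
  have hχK2 : ∀ x ∉ K2, χ x = 0 := fun x hx => (hχ0 x).1 fun hx' => hx (interior_subset hx')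
  have hχc : HasCompactSupport χ := HasCompactSupport.intro hK2 hχK2
  let φ : ContDiffBump p := ⟨r / 2, r, by positivity, by linarith⟩
  have hφs : Function.support φ = Metric.ball p r := φ.support_eq
  have hcond : ∀ t ∈ Set.Icc (0 : ℝ) 1, ∀ x, fderiv ℝ χ x = 0 ∨ φ (u x + t • w x) = 0 := by
    intro t ht x
    by_cases hx1 : x ∈ interior K1
    · left
      have : χ =ᶠ[𝓝 x] fun _ => 1 := by
        filter_upwards [isOpen_interior.mem_nhds hx1] with y hy
        exact (hχ1 y).1 (interior_subset hy)
      rw [this.fderiv_eq, fderiv_const_apply]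
    · by_cases hxΩ : x ∈ Ω
      · right
        by_contra h0
        have : u x + t • w x ∈ Metric.ball p r := hφs ▸ h0
        exact hx1 (hKK1 ⟨(t, x), ⟨⟨ht, subset_closure hxΩ⟩, Metric.ball_subset_closedBall this⟩, rfl⟩)
      · left
        have : χ =ᶠ[𝓝 x] fun _ => 0 := by
          filter_upwards [hK2.isClosed.isOpen_compl.mem_nhds fun hx => hxΩ (hK2Ω hx)] with y hy
          exact hχK2 y hy
        rw [this.fderiv_eq, fderiv_const_apply]
  have hχ1' : ∀ t ∈ Set.Icc (0 : ℝ) 1, ∀ x ∈ Ω, u x + t • w x ∈ Function.support φ → χ x = 1 := by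
    intro t ht x hx hq
    rw [hφs] at hq
    exact (hχ1 x).1 (interior_subset (hKK1
      ⟨(t, x), ⟨⟨ht, subset_closure hx⟩, Metric.ball_subset_closedBall hq⟩, rfl⟩))
  have hχ0' : ∀ x ∉ Ω, χ x = 0 := fun x hx => hχK2 x fun hx' => hx (hK2Ω hx')
  have e0 := H0 φ χ φ.continuous
    (hφs ▸ Metric.ball_subset_ball (hrlt.le.trans (min_le_left _ _)))
    (by simpa using hχ1' 0 (by simp)) hχ0'
  have e1 := H1 φ χ φ.continuous
    (hφs ▸ Metric.ball_subset_ball (hrlt.le.trans ((min_le_right _ _).trans (min_le_left _ _))))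
    (by simpa using hχ1' 1 (by simp)) hχ0'
  have e2 := integral_comp_mul_det_jacobianMatrix_eq hu hw φ.contDiff hχs hχc hcond
  simp only [det_jacobianMatrix] at e2
  rw [e0, e1] at e2
  exact_mod_cast mul_right_cancel₀ (φ.integral_pos (μ := volume)).ne' e2

/-! ### Change of coordinates. -/

section Transfer
variable {V W : Type*} [NormedAddCommGroup V] [NormedSpace ℝ V]
  [NormedAddCommGroup W] [NormedSpace ℝ W]

theorem det_fderiv_conj (e : V ≃L[ℝ] W) (g : V → V) (x : W) :
    (fderiv ℝ (fun y => e (g (e.symm y))) x).det = (fderiv ℝ g (e.symm x)).det := by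
  have h : fderiv ℝ (fun y => e (g (e.symm y))) x =
      (e : V →L[ℝ] W).comp ((fderiv ℝ g (e.symm x)).comp (e.symm : W →L[ℝ] V)) := by
    have h1 : fderiv ℝ (e ∘ (g ∘ e.symm)) x = _ := e.comp_fderiv
    have h2 : fderiv ℝ (g ∘ e.symm) x = _ := e.symm.comp_right_fderiv
    rw [h2] at h1
    exact h1
  rw [h]
  exact LinearMap.det_conj (fderiv ℝ g (e.symm x) : V →ₗ[ℝ] V) e.toLinearEquiv

theorem isRegularValueOn_conj (e : V ≃L[ℝ] W) {g : V → V} {Ω : Set V} {p : V} :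
    IsRegularValueOn (fun y => e (g (e.symm y))) (e.symm ⁻¹' Ω) (e p) ↔ IsRegularValueOn g Ω p := by
  constructor
  · intro h x hx hgx
    have := h (e x) (by simpa using hx) (by simp [hgx])
    rwa [det_fderiv_conj, e.symm_apply_apply] at this
  · intro h x hx hgx
    rw [det_fderiv_conj]
    exact h _ hx (e.injective hgx)

theorem signedCount_conj (e : V ≃L[ℝ] W) (g : V → V) (Ω : Set V) (p : V) :
    signedCount (fun y => e (g (e.symm y))) (e.symm ⁻¹' Ω) (e p) = signedCount g Ω p := by
  refine finsum_mem_eq_of_bijOn e.symm ⟨?_, e.symm.injective.injOn, ?_⟩ ?_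
  · exact fun x hx => ⟨hx.1, e.injective hx.2⟩
  · exact fun x hx => ⟨e x, ⟨by simpa using hx.1, by simp [hx.2]⟩, by simp⟩
  · exact fun x _ => by rw [det_fderiv_conj]

end Transfer

/-- Homotopy invariance of the signed count, for the straight-line homotopy between smooth maps. -/
theorem signedCount_eq_of_forall_segment {V : Type*} [NormedAddCommGroup V] [NormedSpace ℝ V]
    [FiniteDimensional ℝ V] {f g : V → V} (hf : ContDiff ℝ ∞ f) (hg : ContDiff ℝ ∞ g) {Ω : Set V}
    (ho : IsOpen Ω) (hb : Bornology.IsBounded Ω) {p : V}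
    (h : ∀ t ∈ Set.Icc (0 : ℝ) 1, ∀ x ∈ frontier Ω, f x + t • (g x - f x) ≠ p)
    (hf' : IsRegularValueOn f Ω p) (hg' : IsRegularValueOn g Ω p) :
    signedCount f Ω p = signedCount g Ω p := by
  let e : V ≃L[ℝ] (Fin (Module.finrank ℝ V) → ℝ) := ContinuousLinearEquiv.ofFinrankEq (by simp)
  have hcl : closure (e.symm ⁻¹' Ω) = e.symm ⁻¹' closure Ω :=
    (e.symm.toHomeomorph.preimage_closure Ω).symm
  have key := signedCount_eq_of_forall_segment_pi (u := fun y => e (f (e.symm y)))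
    (w := fun y => e (g (e.symm y) - f (e.symm y))) (Ω := e.symm ⁻¹' Ω) (p := e p)
    (by fun_prop) (by fun_prop) (ho.preimage e.symm.continuous)
    (by
      rw [← e.image_eq_preimage_symm]
      exact e.lipschitz.isBounded_image hb)
    (fun t ht x hx hxp => by
      by_contra hxΩ
      rw [hcl] at hx
      refine h t ht (e.symm x) (ho.frontier_eq ▸ ⟨hx, hxΩ⟩) (e.injective ?_)
      simpa using hxp)
    ((isRegularValueOn_conj e).2 hf')
    (by simpa using (isRegularValueOn_conj e).2 hg')
  rw [signedCount_conj] at key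
  rw [key, ← signedCount_conj e g]
  simp

/-! ### Smooth approximation and regular values. -/

/-- Near each point of `K` a constant is admissible, and balls are convex, so a smooth partition of
unity glues the constants. Off `K` nothing is required, which makes `g` smooth on the whole space.
-/
theorem exists_contDiff_approx_on {U F : Type*} [NormedAddCommGroup U] [NormedSpace ℝ U]
    [FiniteDimensional ℝ U] [NormedAddCommGroup F] [NormedSpace ℝ F] {f : U → F}
    {K : Set U} (hK : IsClosed K) (hf : ContinuousOn f K) {ε : ℝ} (hε : 0 < ε) :
    ∃ g : U → F, ContDiff ℝ ∞ g ∧ ∀ x ∈ K, ‖g x - f x‖ < ε := by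
  obtain ⟨g, hg⟩ := exists_contMDiffMap_forall_mem_convex_of_local_const (n := ⊤)
    (modelWithCornersSelf ℝ U) (t := fun x => {y : F | x ∈ K → y ∈ Metric.ball (f x) ε})
    (fun x => by
      by_cases hx : x ∈ K
      · simp only [hx, forall_const]
        exact convex_ball (f x) ε
      · simpa [hx] using convex_univ)
    (fun x => by
      by_cases hx : x ∈ K
      · refine ⟨f x, ?_⟩
        have := (hf x hx).eventually (Metric.ball_mem_nhds (f x) hε)
        filter_upwards [eventually_nhdsWithin_iff.1 this] with y hy hyK
        rw [Metric.mem_ball, dist_comm]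
        exact hy hyK
      · exact ⟨0, by filter_upwards [hK.isOpen_compl.mem_nhds hx] with y hy hyK using absurd hyK hy⟩)
  refine ⟨g, g.contMDiff.contDiff, fun x hx => ?_⟩
  simpa [dist_eq_norm] using hg x hx

/-- A form of Sard's theorem: the critical values of a smooth map have empty interior. -/
theorem exists_small_forall_det_ne_zero {V : Type*} [NormedAddCommGroup V] [NormedSpace ℝ V]
    [FiniteDimensional ℝ V] {g : V → V} (hg : ContDiff ℝ ∞ g) (p : V) {ε : ℝ} (hε : 0 < ε) :
    ∃ c : V, ‖c‖ < ε ∧ ∀ x, g x = p + c → (fderiv ℝ g x).det ≠ 0 := by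
  borelize V
  let μ : Measure V := Measure.addHaar
  have h0 : μ (g '' {x | (fderiv ℝ g x).det = 0}) = 0 :=
    addHaar_image_eq_zero_of_det_fderivWithin_eq_zero μ
      (fun x _ => (hg.differentiable (by simp) x).hasFDerivAt.hasFDerivWithinAt) fun x hx => hx
  have h1 : ¬ Metric.ball p ε ⊆ g '' {x | (fderiv ℝ g x).det = 0} := fun hsub =>
    (Metric.measure_ball_pos μ p hε).ne' (measure_mono_null hsub h0)
  obtain ⟨q, hq, hq'⟩ := Set.not_subset.1 h1
  refine ⟨q - p, by simpa [dist_eq_norm] using hq, fun x hx hdet => hq' ⟨x, hdet, by simpa using hx⟩⟩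

/-- Half of `ε` pays for smoothing, half for the translation by `c` that makes `p` regular.
Regularity holds on all `Ω` at once, so a single `g` can be used on several domains. -/
theorem exists_contDiff_approx_on_regular {V : Type*} [NormedAddCommGroup V] [NormedSpace ℝ V]
    [FiniteDimensional ℝ V] {f : V → V} {K : Set V} (hK : IsClosed K) (hf : ContinuousOn f K)
    (p : V) {ε : ℝ} (hε : 0 < ε) :
    ∃ g : V → V, ContDiff ℝ ∞ g ∧ (∀ x ∈ K, ‖g x - f x‖ < ε) ∧
      ∀ Ω, IsRegularValueOn g Ω p := by
  obtain ⟨g, hg, hgf⟩ := exists_contDiff_approx_on hK hf (half_pos hε)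
  obtain ⟨c, hc, hreg⟩ := exists_small_forall_det_ne_zero hg p (half_pos hε)
  refine ⟨fun x => g x - c, hg.sub contDiff_const, fun x hx => ?_, fun Ω x _ hx => ?_⟩
  · calc ‖g x - c - f x‖ = ‖(g x - f x) - c‖ := by congr 1; abel
      _ ≤ ‖g x - f x‖ + ‖c‖ := norm_sub_le _ _
      _ < ε := by linarith [hgf x hx]
  · rw [fderiv_sub_const]
    exact hreg x (sub_eq_iff_eq_add.1 hx)

/-! ### Brouwer degree: uniqueness, existence, homotopy, excision. -/

section Brouwer
variable {V : Type*} [NormedAddCommGroup V] [NormedSpace ℝ V] [FiniteDimensional ℝ V]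
  {f f' : V → V} {Ω Ω' : Set V} {p : V}

/-- The definition only quantifies over regular approximations; it determines `d` because one exists
within both tolerances. -/
theorem IsBrouwerDegree.unique (hf : ContinuousOn f (closure Ω)) {d d' : ℤ}
    (h : IsBrouwerDegree f Ω p d) (h' : IsBrouwerDegree f Ω p d') : d = d' := by
  obtain ⟨ε, hε, H⟩ := h
  obtain ⟨ε', hε', H'⟩ := h'
  obtain ⟨g, hg, hgf, hreg⟩ := exists_contDiff_approx_on_regular isClosed_closure hf p
    (lt_min hε hε')
  rw [← H g hg (fun x hx => (hgf x hx).trans_le (min_le_left _ _)) (hreg Ω),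
    ← H' g hg (fun x hx => (hgf x hx).trans_le (min_le_right _ _)) (hreg Ω)]

/-- Homotopy invariance of the Brouwer degree for straight-line homotopies. -/
theorem exists_isBrouwerDegree_of_segment (ho : IsOpen Ω) (hb : Bornology.IsBounded Ω)
    (hf : ContinuousOn f (closure Ω)) (hf' : ContinuousOn f' (closure Ω))
    (h : ∀ t ∈ Set.Icc (0 : ℝ) 1, ∀ x ∈ frontier Ω, f x + t • (f' x - f x) ≠ p) :
    ∃ d, IsBrouwerDegree f Ω p d ∧ IsBrouwerDegree f' Ω p d := by
  have := FiniteDimensional.proper ℝ V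
  -- A lower bound for the distance from `p` to the homotopy on the boundary. It serves as the
  -- tolerance `ε` for both degrees: by convexity, replacing the endpoints by maps closer than `μ`
  -- moves every point of the segment by less than `μ`.
  obtain ⟨μ, hμ, hμp⟩ : ∃ μ > 0, ∀ t ∈ Set.Icc (0 : ℝ) 1, ∀ x ∈ frontier Ω,
      μ ≤ ‖f x + t • (f' x - f x) - p‖ := by
    have hK : IsCompact (Set.Icc (0 : ℝ) 1 ×ˢ frontier Ω) :=
      isCompact_Icc.prod (hb.isCompact_closure.of_isClosed_subset isClosed_frontier
        frontier_subset_closure)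
    have hc : ContinuousOn (fun q : ℝ × V => f q.2 + q.1 • (f' q.2 - f q.2))
        (Set.Icc (0 : ℝ) 1 ×ˢ frontier Ω) := by
      have h1 : ContinuousOn (fun q : ℝ × V => f q.2) (Set.Icc (0 : ℝ) 1 ×ˢ frontier Ω) :=
        hf.comp continuousOn_snd fun q hq => frontier_subset_closure hq.2
      have h2 : ContinuousOn (fun q : ℝ × V => f' q.2) (Set.Icc (0 : ℝ) 1 ×ˢ frontier Ω) :=
        hf'.comp continuousOn_snd fun q hq => frontier_subset_closure hq.2
      exact h1.add (continuousOn_fst.smul (h2.sub h1))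
    have hp : p ∉ (fun q : ℝ × V => f q.2 + q.1 • (f' q.2 - f q.2)) ''
        (Set.Icc (0 : ℝ) 1 ×ˢ frontier Ω) := by
      rintro ⟨⟨t, x⟩, hx, hxp⟩
      exact h t hx.1 x hx.2 hxp
    obtain ⟨μ, hμ, hsub⟩ := Metric.mem_nhds_iff.1
      ((hK.image_of_continuousOn hc).isClosed.isOpen_compl.mem_nhds hp)
    refine ⟨μ, hμ, fun t ht x hx => ?_⟩
    by_contra! hcon
    exact hsub (by simpa [dist_eq_norm] using hcon) ⟨(t, x), ⟨ht, hx⟩, rfl⟩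
  have key : ∀ g g' : V → V, ContDiff ℝ ∞ g → ContDiff ℝ ∞ g' →
      (∀ x ∈ closure Ω, ‖g x - f x‖ < μ) → (∀ x ∈ closure Ω, ‖g' x - f' x‖ < μ) →
      IsRegularValueOn g Ω p → IsRegularValueOn g' Ω p →
      signedCount g Ω p = signedCount g' Ω p := by
    intro g g' hg hg' hgf hgf' hr hr'
    refine signedCount_eq_of_forall_segment hg hg' ho hb (fun t ht x hx hxp => ?_) hr hr'
    have hx' := frontier_subset_closure hx
    refine absurd (hμp t ht x hx) (not_le.2 ?_)
    have hmem := (convex_ball (0 : V) μ) (x := g x - f x) (y := g' x - f' x)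
      (by simpa using hgf x hx') (by simpa using hgf' x hx') (a := 1 - t) (b := t)
      (by linarith [ht.2]) ht.1 (by ring)
    rw [mem_ball_zero_iff] at hmem
    have e : f x + t • (f' x - f x) - p = -((1 - t) • (g x - f x) + t • (g' x - f' x)) := by
      rw [← hxp]
      module
    rwa [e, norm_neg]
  obtain ⟨g0, hg0, hgf0, hr0⟩ := exists_contDiff_approx_on_regular isClosed_closure hf p hμ
  obtain ⟨g1, hg1, hgf1, hr1⟩ := exists_contDiff_approx_on_regular isClosed_closure hf' p hμ
  refine ⟨signedCount g0 Ω p, ⟨μ, hμ, fun g hg hgf hr => ?_⟩, ⟨μ, hμ, fun g hg hgf hr => ?_⟩⟩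
  · rw [key g g1 hg hg1 hgf hgf1 hr (hr1 _), key g0 g1 hg0 hg1 hgf0 hgf1 (hr0 _) (hr1 _)]
  · rw [key g0 g hg0 hg hgf0 hgf (hr0 _) hr]

theorem exists_isBrouwerDegree (ho : IsOpen Ω) (hb : Bornology.IsBounded Ω)
    (hf : ContinuousOn f (closure Ω)) (h : ∀ x ∈ frontier Ω, f x ≠ p) :
    ∃ d, IsBrouwerDegree f Ω p d := by
  obtain ⟨d, hd, -⟩ := exists_isBrouwerDegree_of_segment ho hb hf hf
    (fun t _ x hx => by simpa using h x hx)
  exact ⟨d, hd⟩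

theorem IsBrouwerDegree.of_segment (ho : IsOpen Ω) (hb : Bornology.IsBounded Ω)
    (hf : ContinuousOn f (closure Ω)) (hf' : ContinuousOn f' (closure Ω))
    (h : ∀ t ∈ Set.Icc (0 : ℝ) 1, ∀ x ∈ frontier Ω, f x + t • (f' x - f x) ≠ p) {d : ℤ}
    (hd : IsBrouwerDegree f Ω p d) : IsBrouwerDegree f' Ω p d := by
  obtain ⟨d', h1, h2⟩ := exists_isBrouwerDegree_of_segment ho hb hf hf' h
  rwa [hd.unique hf h1]

/-- Excision. -/
theorem IsBrouwerDegree.excision (ho' : IsOpen Ω') (hb : Bornology.IsBounded Ω)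
    (hsub : Ω' ⊆ Ω) (hf : ContinuousOn f (closure Ω)) (h : ∀ x ∈ closure Ω, x ∉ Ω' → f x ≠ p)
    {d : ℤ} (hd : IsBrouwerDegree f Ω p d) : IsBrouwerDegree f Ω' p d := by
  have := FiniteDimensional.proper ℝ V
  have hcl := closure_mono hsub
  obtain ⟨d', hd'⟩ := exists_isBrouwerDegree ho' (hb.subset hsub) (hf.mono hcl)
    (fun x hx => h x (hcl (frontier_subset_closure hx)) (ho'.frontier_eq ▸ hx).2)
  -- An approximation closer than `μ` has no solutions in `Ω` outside `Ω'`, so both counts run over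
  -- the same set.
  obtain ⟨μ, hμ, hμp⟩ : ∃ μ > 0, ∀ x ∈ closure Ω, x ∉ Ω' → μ ≤ ‖f x - p‖ := by
    have hK : IsCompact (f '' (closure Ω \ Ω')) :=
      (hb.isCompact_closure.diff ho').image_of_continuousOn (hf.mono Set.sdiff_subset)
    have hp : p ∉ f '' (closure Ω \ Ω') := by
      rintro ⟨x, hx, hxp⟩
      exact h x hx.1 hx.2 hxp
    obtain ⟨μ, hμ, hsub⟩ := Metric.mem_nhds_iff.1 (hK.isClosed.isOpen_compl.mem_nhds hp)
    refine ⟨μ, hμ, fun x hx hx' => ?_⟩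
    by_contra! hcon
    exact hsub (by simpa [dist_eq_norm] using hcon) ⟨x, ⟨hx, hx'⟩, rfl⟩
  obtain ⟨ε, hε, H⟩ := id hd
  obtain ⟨ε', hε', H'⟩ := id hd'
  obtain ⟨g, hg, hgf, hreg⟩ := exists_contDiff_approx_on_regular isClosed_closure hf p
    (lt_min hμ (lt_min hε hε'))
  have hset : {x | x ∈ Ω' ∧ g x = p} = {x | x ∈ Ω ∧ g x = p} := by
    ext x
    refine ⟨fun hx => ⟨hsub hx.1, hx.2⟩, fun hx => ⟨?_, hx.2⟩⟩
    by_contra hx'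
    have h1 := hμp x (subset_closure hx.1) hx'
    have h2 := (hgf x (subset_closure hx.1)).trans_le (min_le_left _ _)
    rw [hx.2, norm_sub_rev] at h2
    linarith
  have e1 := H g hg (fun x hx => (hgf x hx).trans_le
    ((min_le_right _ _).trans (min_le_left _ _))) (hreg _)
  have e2 := H' g hg (fun x hx => (hgf x (hcl hx)).trans_le
    ((min_le_right _ _).trans (min_le_right _ _))) (hreg _)
  have e3 : signedCount g Ω' p = signedCount g Ω p := by rw [signedCount, signedCount, hset]
  rwa [← e1, ← e3, e2]

end Brouwer

/-! ### Independence of the ambient finite-dimensional space. -/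

theorem LinearMap.det_one_sub_comp_comm {K V U : Type*} [Field K] [AddCommGroup V] [Module K V]
    [FiniteDimensional K V] [AddCommGroup U] [Module K U] [FiniteDimensional K U]
    (A : V →ₗ[K] U) (B : U →ₗ[K] V) :
    LinearMap.det (LinearMap.id - A ∘ₗ B) = LinearMap.det (LinearMap.id - B ∘ₗ A) := by
  classical
  let b := Module.finBasis K V
  let c := Module.finBasis K U
  rw [← LinearMap.det_toMatrix b, ← LinearMap.det_toMatrix c, map_sub, map_sub,
    LinearMap.toMatrix_id, LinearMap.toMatrix_id, LinearMap.toMatrix_comp c b c,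
    LinearMap.toMatrix_comp b c b, Matrix.det_one_sub_mul_comm]

section Reduction
variable {V U : Type*} [NormedAddCommGroup V] [NormedSpace ℝ V] [FiniteDimensional ℝ V]
  [NormedAddCommGroup U] [NormedSpace ℝ U] [FiniteDimensional ℝ U]

theorem det_fderiv_sub_comp (ι : V →L[ℝ] U) {h : U → V} (hh : ContDiff ℝ ∞ h) (v : V) :
    (fderiv ℝ (fun u => u - ι (h u)) (ι v)).det = (fderiv ℝ (fun v => v - h (ι v)) v).det := by
  have hd : HasFDerivAt h (fderiv ℝ h (ι v)) (ι v) :=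
    (hh.differentiable (by simp) _).hasFDerivAt
  have h1 : HasFDerivAt (fun u => u - ι (h u))
      (ContinuousLinearMap.id ℝ U - ι.comp (fderiv ℝ h (ι v))) (ι v) :=
    (hasFDerivAt_id _).sub (ι.hasFDerivAt.comp _ hd)
  have h2 : HasFDerivAt (fun v => v - h (ι v))
      (ContinuousLinearMap.id ℝ V - (fderiv ℝ h (ι v)).comp ι) v :=
    (hasFDerivAt_id _).sub (hd.comp _ ι.hasFDerivAt)
  rw [h1.fderiv, h2.fderiv]
  exact LinearMap.det_one_sub_comp_comm (ι : V →ₗ[ℝ] U) (fderiv ℝ h (ι v) : U →ₗ[ℝ] V)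

/-- The Brouwer degree of a perturbation of the identity by a map with values in a subspace
is the degree of its restriction to the subspace. -/
theorem IsBrouwerDegree.reduction {ι : V →L[ℝ] U} (hι : Function.Injective ι) {T : U → V}
    {Ω : Set U} (ho : IsOpen Ω) (hb : Bornology.IsBounded Ω) (hT : ContinuousOn T (closure Ω))
    {p : V} (hp : ∀ u ∈ frontier Ω, u - ι (T u) ≠ ι p) {d : ℤ}
    (hd : IsBrouwerDegree (fun v => v - T (ι v)) (ι ⁻¹' Ω) p d) :
    IsBrouwerDegree (fun u => u - ι (T u)) Ω (ι p) d := by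
  have hcont : ContinuousOn (fun u => u - ι (T u)) (closure Ω) :=
    continuousOn_id.sub (ι.continuous.comp_continuousOn hT)
  obtain ⟨d', hd'⟩ := exists_isBrouwerDegree ho hb hcont hp
  obtain ⟨ε, hε, H⟩ := id hd
  obtain ⟨ε', hε', H'⟩ := id hd'
  -- An error below `η` in `V` respects the tolerance `ε` there and, after applying `ι`, the
  -- tolerance `ε'` in `U`. The `+ 1` avoids dividing by zero.
  set η := min ε (ε' / (‖ι‖ + 1)) with hη
  have hηpos : 0 < η := lt_min hε (div_pos hε' (by positivity))
  obtain ⟨h0, hh0, hhT⟩ := exists_contDiff_approx_on isClosed_closure hT (half_pos hηpos)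
  obtain ⟨c, hc, hreg⟩ := exists_small_forall_det_ne_zero (g := fun v => v - h0 (ι v))
    (contDiff_id.sub (hh0.comp ι.contDiff)) p (half_pos hηpos)
  let h : U → V := fun u => h0 u + c
  have hh : ContDiff ℝ ∞ h := hh0.add contDiff_const
  have hhT' : ∀ u ∈ closure Ω, ‖T u - h u‖ < η := fun u hu => by
    calc ‖T u - h u‖ = ‖(h0 u - T u) + c‖ := by
          rw [← norm_neg]; congr 1; simp only [h]; abel
      _ ≤ ‖h0 u - T u‖ + ‖c‖ := norm_add_le _ _
      _ < η := by linarith [hhT u hu]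
  have hregV : ∀ v, v - h (ι v) = p → (fderiv ℝ (fun v => v - h (ι v)) v).det ≠ 0 := by
    intro v hv
    have : (fun v => v - h (ι v)) = fun v => (v - h0 (ι v)) - c := by
      funext v; simp only [h]; abel
    rw [this, fderiv_sub_const]
    refine hreg v ?_
    rw [← hv]; simp only [h]; abel
  -- Solutions in `U` satisfy `u = ι (p + h u)`, hence come from `V`. Regularity arranged in `V`
  -- thus passes to `U` by the determinant identity.
  have hsol : ∀ u, u - ι (h u) = ι p → ∃ v, ι v = u ∧ v - h (ι v) = p := by
    intro u hu
    have hv : ι (p + h u) = u := by rw [map_add, ← hu]; abel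
    refine ⟨p + h u, hv, ?_⟩
    rw [hv]; abel
  have hbound : ∀ u ∈ closure Ω, ‖(u - ι (h u)) - (u - ι (T u))‖ < ε' := by
    intro u hu
    have e : (u - ι (h u)) - (u - ι (T u)) = ι (T u - h u) := by rw [map_sub]; abel
    rw [e]
    calc ‖ι (T u - h u)‖ ≤ ‖ι‖ * ‖T u - h u‖ := ι.le_opNorm _
      _ ≤ (‖ι‖ + 1) * ‖T u - h u‖ := by gcongr; linarith
      _ < (‖ι‖ + 1) * (ε' / (‖ι‖ + 1)) := by
          gcongr
          exact (hhT' u hu).trans_le (min_le_right _ _)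
      _ = ε' := by field_simp
  have e1 := H (fun v => v - h (ι v)) (contDiff_id.sub (hh.comp ι.contDiff))
    (fun v hv => by
      have e : (v - h (ι v)) - (v - T (ι v)) = T (ι v) - h (ι v) := by abel
      rw [e]
      exact (hhT' _ (ι.continuous.closure_preimage_subset Ω hv)).trans_le (min_le_left _ _))
    (fun v _ hv => hregV v hv)
  have e2 := H' (fun u => u - ι (h u)) (contDiff_id.sub (ι.contDiff.comp hh)) hbound
    (fun u _ hu => by
      obtain ⟨v, rfl, hv⟩ := hsol u hu
      rw [det_fderiv_sub_comp ι hh]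
      exact hregV v hv)
  have e3 : signedCount (fun v => v - h (ι v)) (ι ⁻¹' Ω) p =
      signedCount (fun u => u - ι (h u)) Ω (ι p) := by
    refine finsum_mem_eq_of_bijOn ι ⟨?_, hι.injOn, ?_⟩ ?_
    · rintro v ⟨hv, hvp⟩
      refine ⟨hv, ?_⟩
      change ι v - ι (h (ι v)) = ι p
      rw [← map_sub]
      exact congrArg ι hvp
    · rintro u ⟨hu, hup⟩
      obtain ⟨v, rfl, hv⟩ := hsol u hup
      exact ⟨v, ⟨hu, hv⟩, rfl⟩
    · intro v _
      rw [det_fderiv_sub_comp ι hh]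
  rwa [← e1, e3, e2]

end Reduction

/-! ### Compact perturbations of the identity and Schauder approximation. -/

/-- A compact perturbation of the identity depending continuously on a parameter stays locally
uniformly away from a value which it does not attain on a closed set. -/
theorem exists_eventually_forall_le_norm_sub {Λ E : Type*} [TopologicalSpace Λ]
    [NormedAddCommGroup E] {H : Λ → E → E} {s : Set Λ} {A B : Set E} (hA : IsClosed A)
    (hAB : A ⊆ B) (hH : ContinuousOn (Function.uncurry H) (s ×ˢ B))
    (hc : IsCompact (closure (Function.uncurry H '' (s ×ˢ B)))) {p : E} {a : Λ} (ha : a ∈ s)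
    (hp : ∀ x ∈ A, x - H a x ≠ p) :
    ∃ δ > 0, ∀ᶠ b in 𝓝[s] a, ∀ x ∈ A, δ ≤ ‖x - H b x - p‖ := by
  -- If `l` were nontrivial, an ultrafilter below it would give parameters tending to `a` and points
  -- of `A` with `x - H b x → p`. Compactness makes `H b x` converge, hence also `x`, to a forbidden
  -- solution at `a`.
  let l : Filter (Λ × E) := (𝓝[s] a ×ˢ Filter.principal A) ⊓
    Filter.comap (fun q : Λ × E => q.2 - H q.1 q.2) (𝓝 p)
  have hl : l = ⊥ := by
    by_contra hne
    have : l.NeBot := ⟨hne⟩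
    let u := Ultrafilter.of l
    have hu : (u : Filter (Λ × E)) ≤ l := Ultrafilter.of_le l
    have hu1 : Filter.Tendsto Prod.fst (u : Filter (Λ × E)) (𝓝[s] a) :=
      Filter.tendsto_fst.mono_left (hu.trans inf_le_left)
    have hus : ∀ᶠ q in (u : Filter (Λ × E)), q.1 ∈ s := hu1.eventually self_mem_nhdsWithin
    have huA : ∀ᶠ q in (u : Filter (Λ × E)), q.2 ∈ A :=
      (Filter.tendsto_snd.mono_left (hu.trans inf_le_left)).eventually
        (Filter.mem_principal_self A)
    have hu2 : Filter.Tendsto (fun q : Λ × E => q.2 - H q.1 q.2) (u : Filter (Λ × E)) (𝓝 p) :=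
      Filter.tendsto_comap.mono_left (hu.trans inf_le_right)
    obtain ⟨y, -, hy⟩ := hc.ultrafilter_le_nhds (u.map (Function.uncurry H)) (by
      rw [Filter.le_principal_iff]
      change ∀ᶠ q in (u : Filter (Λ × E)), Function.uncurry H q ∈ closure _
      filter_upwards [hus, huA] with q h1 h2
      exact subset_closure ⟨q, ⟨h1, hAB h2⟩, rfl⟩)
    have hy' : Filter.Tendsto (fun q : Λ × E => H q.1 q.2) (u : Filter (Λ × E)) (𝓝 y) := hy
    have hx : Filter.Tendsto (fun q : Λ × E => q.2) (u : Filter (Λ × E)) (𝓝 (p + y)) := by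
      simpa using hu2.add hy'
    have hxA : p + y ∈ A := hA.mem_of_tendsto hx huA
    have hq : Filter.Tendsto (fun q : Λ × E => q) (u : Filter (Λ × E))
        (𝓝[s ×ˢ B] (a, p + y)) := by
      refine tendsto_nhdsWithin_iff.2 ⟨?_, ?_⟩
      · exact (hu1.mono_right nhdsWithin_le_nhds).prodMk_nhds hx
      · filter_upwards [hus, huA] with q h1 h2
        exact ⟨h1, hAB h2⟩
    have hlim := (hH (a, p + y) ⟨ha, hAB hxA⟩).tendsto.comp hq
    have heq : y = H a (p + y) := tendsto_nhds_unique hy' hlim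
    exact hp _ hxA (by rw [← heq]; abel)
  have hmem : (∅ : Set (Λ × E)) ∈ l := hl ▸ Filter.mem_bot
  obtain ⟨t1, ht1, t2, ht2, ht⟩ := Filter.mem_inf_iff.1 hmem
  obtain ⟨t3, ht3, ht23⟩ := Filter.mem_comap.1 ht2
  obtain ⟨δ, hδ, hball⟩ := Metric.mem_nhds_iff.1 ht3
  refine ⟨δ, hδ, ?_⟩
  filter_upwards [Filter.mem_prod_principal.1 ht1] with b hb x hx
  by_contra! hcon
  have : (b, x) ∈ (∅ : Set (Λ × E)) := by
    rw [ht]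
    exact ⟨hb x hx, ht23 (hball (by simpa [dist_eq_norm] using hcon))⟩
  exact this

theorem exists_forall_le_norm_sub {E : Type*} [NormedAddCommGroup E] {T : E → E} {A B : Set E}
    (hA : IsClosed A) (hAB : A ⊆ B) (hT : ContinuousOn T B) (hc : IsCompact (closure (T '' B)))
    {p : E} (hp : ∀ x ∈ A, x - T x ≠ p) : ∃ δ > 0, ∀ x ∈ A, δ ≤ ‖x - T x - p‖ := by
  have himg : Function.uncurry (fun _ : Unit => T) '' (Set.univ ×ˢ B) = T '' B := by
    ext y
    simp
  obtain ⟨δ, hδ, h⟩ := exists_eventually_forall_le_norm_sub (H := fun _ : Unit => T)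
    (s := Set.univ) (a := ()) hA hAB (hT.comp continuousOn_snd fun q hq => hq.2)
    (by rwa [himg]) trivial hp
  exact ⟨δ, hδ, h.self_of_nhdsWithin trivial⟩

/-- Schauder's finite-dimensional approximation of a compact map. -/
theorem exists_finiteDimensional_approx {X E : Type*} [TopologicalSpace X] [NormedAddCommGroup E]
    [NormedSpace ℝ E] {T : X → E} {A : Set X} (hT : ContinuousOn T A)
    (hc : IsCompact (closure (T '' A))) (p : E) {ε : ℝ} (hε : 0 < ε) :
    ∃ (V : Submodule ℝ E) (_ : FiniteDimensional ℝ V) (_ : p ∈ V) (T' : X → V),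
      ContinuousOn T' A ∧ ∀ x ∈ A, ‖(T' x : E) - T x‖ < ε := by
  classical
  obtain ⟨t, -, hcov⟩ := hc.elim_nhds_subcover (fun y => Metric.ball y ε)
    fun y _ => Metric.ball_mem_nhds y hε
  -- The net `t` would suffice for the approximation; `p` is added because the degree in `V` needs
  -- `p ∈ V`.
  let V : Submodule ℝ E := Submodule.span ℝ (insert p t : Finset E)
  have hV : ∀ y ∈ t, y ∈ V := fun y hy => Submodule.subset_span (by simp [hy])
  -- Only the points of the net closer than `ε` to `T x` get weight, so their weighted mean is
  -- closer than `ε` too.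
  let w : E → X → ℝ := fun y x => max 0 (ε - ‖T x - y‖)
  have hw0 : ∀ y x, 0 ≤ w y x := fun y x => le_max_left _ _
  have hwc : ∀ y, ContinuousOn (w y) A := fun y =>
    ContinuousOn.sup continuousOn_const (continuousOn_const.sub (hT.sub continuousOn_const).norm)
  have hpos : ∀ x ∈ A, ∃ y ∈ t, 0 < w y x := by
    intro x hx
    obtain ⟨y, hy, hxy⟩ := Set.mem_iUnion₂.1 (hcov (subset_closure ⟨x, hx, rfl⟩))
    refine ⟨y, hy, lt_max_of_lt_right ?_⟩
    rw [Metric.mem_ball, dist_eq_norm] at hxy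
    linarith
  have hsum : ∀ x ∈ A, 0 < ∑ y ∈ t, w y x := fun x hx => by
    obtain ⟨y, hy, hyx⟩ := hpos x hx
    exact Finset.sum_pos' (fun y _ => hw0 y x) ⟨y, hy, hyx⟩
  let T' : X → V := fun x => (∑ y ∈ t, w y x)⁻¹ • ∑ y ∈ t.attach, w y x • (⟨y, hV y y.2⟩ : V)
  have hT' : ∀ x, (T' x : E) = (∑ y ∈ t, w y x)⁻¹ • ∑ y ∈ t, w y x • y := by
    intro x
    simp only [T', Submodule.coe_smul, Submodule.coe_sum]
    rw [Finset.sum_attach t fun y => w y x • y]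
  refine ⟨V, FiniteDimensional.span_finset ℝ _, Submodule.subset_span (by simp), T', ?_, ?_⟩
  · refine ContinuousOn.smul (ContinuousOn.inv₀ (continuousOn_finsetSum _ fun y _ => hwc y)
      fun x hx => (hsum x hx).ne') (continuousOn_finsetSum _ fun y _ =>
        (hwc y).smul continuousOn_const)
  · intro x hx
    have hs := hsum x hx
    have e : (T' x : E) - T x = (∑ y ∈ t, w y x)⁻¹ • ∑ y ∈ t, w y x • (y - T x) := by
      simp only [hT', smul_sub, Finset.sum_sub_distrib, ← Finset.sum_smul]
      rw [inv_smul_smul₀ hs.ne']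
    rw [e, norm_smul, norm_inv, Real.norm_of_nonneg hs.le, inv_mul_lt_iff₀ hs, Finset.sum_mul]
    refine (norm_sum_le _ _).trans_lt ?_
    obtain ⟨y, hy, hyx⟩ := hpos x hx
    have hlt : ∀ z, 0 < w z x → ‖z - T x‖ < ε := fun z hz => by
      have := (lt_max_iff.1 hz).resolve_left (lt_irrefl _)
      rw [norm_sub_rev]
      linarith
    refine Finset.sum_lt_sum (fun z _ => ?_) ⟨y, hy, ?_⟩
    · rw [norm_smul, Real.norm_of_nonneg (hw0 z x)]
      rcases (hw0 z x).eq_or_lt with h | h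
      · simp [← h]
      · exact mul_le_mul_of_nonneg_left (hlt z h).le h.le
    · rw [norm_smul, Real.norm_of_nonneg (hw0 y x)]
      exact mul_lt_mul_of_pos_left (hlt y hyx) hyx

/-! ### Leray–Schauder degree: existence, homotopy, excision. -/

section LeraySchauder
variable {E : Type*} [NormedAddCommGroup E] [NormedSpace ℝ E]

theorem isBounded_preimage_coe (V : Submodule ℝ E) {Ω : Set E} (hb : Bornology.IsBounded Ω) :
    Bornology.IsBounded {v : V | (v : E) ∈ Ω} :=
  V.subtypeₗᵢ.isometry.antilipschitz.isBounded_preimage hb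

theorem coe_mem_closure (V : Submodule ℝ E) {Ω : Set E} {v : V}
    (hv : v ∈ closure {v : V | (v : E) ∈ Ω}) : (v : E) ∈ closure Ω :=
  continuous_subtype_val.closure_preimage_subset Ω hv

theorem coe_mem_frontier (V : Submodule ℝ E) {Ω : Set E} {v : V}
    (hv : v ∈ frontier {v : V | (v : E) ∈ Ω}) : (v : E) ∈ frontier Ω :=
  continuous_subtype_val.frontier_preimage_subset Ω hv

theorem continuousOn_sub_restrict {V : Submodule ℝ E} {Ω : Set E} {T' : E → V}
    (hT' : ContinuousOn T' (closure Ω)) :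
    ContinuousOn (fun v : V => v - T' (v : E)) (closure {v : V | (v : E) ∈ Ω}) :=
  continuousOn_id.sub (hT'.comp continuous_subtype_val.continuousOn fun _ hv => coe_mem_closure V hv)

/-- The Leray–Schauder degree can be computed from all finite-dimensional approximations which are
closer than the distance of `p` to the image of the boundary. -/
theorem exists_forall_isBrouwerDegree {T : E → E} {Ω : Set E} {p : E} {δ : ℝ} (ho : IsOpen Ω)
    (hb : Bornology.IsBounded Ω) (hT : ContinuousOn T (closure Ω))
    (hc : IsCompact (closure (T '' closure Ω))) (hδ : 0 < δ)
    (hp : ∀ x ∈ frontier Ω, δ ≤ ‖x - T x - p‖) :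
    ∃ d : ℤ, ∀ (V : Submodule ℝ E) (_ : FiniteDimensional ℝ V) (hpV : p ∈ V) (T' : E → V),
      ContinuousOn T' (closure Ω) → (∀ x ∈ closure Ω, ‖(T' x : E) - T x‖ < δ) →
      IsBrouwerDegree (fun v : V => v - T' (v : E)) {v : V | (v : E) ∈ Ω} ⟨p, hpV⟩ d := by
  have hne : ∀ x ∈ frontier Ω, ∀ z : E, ‖z - T x‖ < δ → x - z ≠ p := by
    rintro x hx z hz rfl
    have h := hp x hx
    rw [sub_sub_sub_cancel_left] at h
    exact absurd h (not_le.2 hz)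
  obtain ⟨V₀, hV₀, hpV₀, T₀, hT₀, hT₀T⟩ := exists_finiteDimensional_approx hT hc p hδ
  have hex : ∀ (V : Submodule ℝ E) (_ : FiniteDimensional ℝ V) (hpV : p ∈ V) (T' : E → V),
      ContinuousOn T' (closure Ω) → (∀ x ∈ closure Ω, ‖(T' x : E) - T x‖ < δ) →
      ∃ d, IsBrouwerDegree (fun v : V => v - T' (v : E)) {v : V | (v : E) ∈ Ω} ⟨p, hpV⟩ d := by
    intro V _ hpV T' hT' hT'T
    refine exists_isBrouwerDegree (ho.preimage continuous_subtype_val)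
      (isBounded_preimage_coe V hb) (continuousOn_sub_restrict hT') fun v hv hvp => ?_
    have hv' := coe_mem_frontier V hv
    exact hne v hv' (T' v) (hT'T v (frontier_subset_closure hv')) (congrArg Subtype.val hvp)
  have hup : ∀ (V : Submodule ℝ E) (_ : FiniteDimensional ℝ V) (hpV : p ∈ V) (T' : E → V)
      (U : Submodule ℝ E) (_ : FiniteDimensional ℝ U) (hVU : V ≤ U) (d : ℤ),
      ContinuousOn T' (closure Ω) → (∀ x ∈ closure Ω, ‖(T' x : E) - T x‖ < δ) →
      IsBrouwerDegree (fun v : V => v - T' (v : E)) {v : V | (v : E) ∈ Ω} ⟨p, hpV⟩ d →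
      IsBrouwerDegree (fun u : U => u - Submodule.inclusion hVU (T' (u : E)))
        {u : U | (u : E) ∈ Ω} ⟨p, hVU hpV⟩ d := by
    intro V _ hpV T' U _ hVU d hT' hT'T hd
    let ι : V →L[ℝ] U := LinearMap.toContinuousLinearMap (Submodule.inclusion hVU)
    exact IsBrouwerDegree.reduction (ι := ι) (T := fun u : U => T' u) (p := ⟨p, hpV⟩)
      (Submodule.inclusion_injective hVU) (ho.preimage continuous_subtype_val)
      (isBounded_preimage_coe U hb)
      (hT'.comp continuous_subtype_val.continuousOn fun _ hv => coe_mem_closure U hv)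
      (fun u hu hup => by
        have hu' := coe_mem_frontier U hu
        exact hne u hu' (T' u) (hT'T u (frontier_subset_closure hu')) (congrArg Subtype.val hup)) hd
  obtain ⟨d, hd⟩ := hex V₀ hV₀ hpV₀ T₀ hT₀ hT₀T
  refine ⟨d, fun V hV hpV T' hT' hT'T => ?_⟩
  obtain ⟨d', hd'⟩ := hex V hV hpV T' hT' hT'T
  -- Both degrees are carried to the common space `V₀ ⊔ V`. There the segment between the
  -- approximations stays within `δ` of `T`, by convexity of balls, so it avoids `p` on the
  -- boundary.
  have hU : FiniteDimensional ℝ (V₀ ⊔ V : Submodule ℝ E) := inferInstance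
  have h1 := hup V₀ hV₀ hpV₀ T₀ (V₀ ⊔ V) hU le_sup_left d hT₀ hT₀T hd
  have h2 := hup V hV hpV T' (V₀ ⊔ V) hU le_sup_right d' hT' hT'T hd'
  have hcont : ∀ (W : Submodule ℝ E) (hWU : W ≤ V₀ ⊔ V) (T'' : E → W),
      ContinuousOn T'' (closure Ω) →
      ContinuousOn (fun u : (V₀ ⊔ V : Submodule ℝ E) => u - Submodule.inclusion hWU (T'' (u : E)))
        (closure {u : (V₀ ⊔ V : Submodule ℝ E) | (u : E) ∈ Ω}) := fun W hWU T'' hT'' =>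
    continuousOn_id.sub ((continuous_inclusion hWU).comp_continuousOn
      (hT''.comp continuous_subtype_val.continuousOn fun _ hv => coe_mem_closure _ hv))
  have h3 := h1.of_segment (ho.preimage continuous_subtype_val) (isBounded_preimage_coe _ hb)
    (hcont _ le_sup_left T₀ hT₀) (hcont _ le_sup_right T' hT') (fun t ht u hu hup => by
      have hu' := coe_mem_frontier _ hu
      have hu'' := frontier_subset_closure hu'
      have hmem := (convex_ball (T (u : E)) δ) (x := T₀ u) (y := T' u)
        (by simpa [dist_eq_norm] using hT₀T u hu'') (by simpa [dist_eq_norm] using hT'T u hu'')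
        (a := 1 - t) (b := t) (by linarith [ht.2]) ht.1 (by ring)
      rw [Metric.mem_ball, dist_eq_norm] at hmem
      refine hne u hu' _ hmem ?_
      have := congrArg Subtype.val hup
      simp only [Submodule.coe_add, Submodule.coe_sub, Submodule.coe_smul,
        Submodule.coe_inclusion] at this
      rw [← this]
      module)
  rwa [h3.unique (hcont _ le_sup_right T' hT') h2]

variable {T : E → E} {Ω Ω' : Set E} {p : E}

theorem IsLeraySchauderDegree.congr {S S' : E → E} (h : Set.EqOn S S' (closure Ω)) {d : ℤ}
    (hd : IsLeraySchauderDegree S Ω p d) : IsLeraySchauderDegree S' Ω p d := by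
  obtain ⟨ε, hε, H⟩ := hd
  exact ⟨ε, hε, fun V hV hpV T' hT' hT'S => H V hV hpV T' hT' fun x hx => by
    rw [h hx]; exact hT'S x hx⟩

/-- The defining predicates coincide, so the chosen integers do, even where no degree exists. -/
theorem leraySchauderDegree_congr {S S' : E → E} (h : Set.EqOn S S' (closure Ω)) :
    leraySchauderDegree S Ω p = leraySchauderDegree S' Ω p := by
  have : IsLeraySchauderDegree S Ω p = IsLeraySchauderDegree S' Ω p := by
    funext d
    exact propext ⟨fun hd => hd.congr h, fun hd => hd.congr h.symm⟩
  rw [leraySchauderDegree, this, leraySchauderDegree]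

theorem existsUnique_isLeraySchauderDegree (ho : IsOpen Ω) (hb : Bornology.IsBounded Ω)
    (hT : ContinuousOn T (closure Ω)) (hc : IsCompact (closure (T '' closure Ω)))
    (hp : ∀ x ∈ frontier Ω, x - T x ≠ p) :
    ∃! d : ℤ, IsLeraySchauderDegree (fun x => x - T x) Ω p d := by
  obtain ⟨δ, hδ, hδp⟩ := exists_forall_le_norm_sub isClosed_frontier frontier_subset_closure hT hc hp
  obtain ⟨d, hd⟩ := exists_forall_isBrouwerDegree ho hb hT hc hδ hδp
  refine ⟨d, ⟨δ, hδ, fun V hV hpV T' hT' hT'S => hd V hV hpV T' hT' fun x hx => ?_⟩, ?_⟩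
  · simpa only [sub_sub_sub_cancel_left, norm_sub_rev] using hT'S x hx
  · rintro d' ⟨ε, hε, H⟩
    obtain ⟨V, hV, hpV, T', hT', hT'T⟩ := exists_finiteDimensional_approx hT hc p (lt_min hδ hε)
    refine IsBrouwerDegree.unique (continuousOn_sub_restrict hT') (H V hV hpV T' hT' fun x hx => ?_)
      (hd V hV hpV T' hT' fun x hx => (hT'T x hx).trans_le (min_le_left _ _))
    simpa only [sub_sub_sub_cancel_left, norm_sub_rev] using (hT'T x hx).trans_le (min_le_right _ _)

theorem isLeraySchauderDegree_leraySchauderDegree (ho : IsOpen Ω) (hb : Bornology.IsBounded Ω)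
    (hT : ContinuousOn T (closure Ω)) (hc : IsCompact (closure (T '' closure Ω)))
    (hp : ∀ x ∈ frontier Ω, x - T x ≠ p) :
    IsLeraySchauderDegree (fun x => x - T x) Ω p (leraySchauderDegree (fun x => x - T x) Ω p) :=
  Classical.epsilon_spec (existsUnique_isLeraySchauderDegree ho hb hT hc hp).exists

/-- Replaces the unspecified tolerance of the definition by the explicit `δ`; this lets one
approximation compute several degrees at once. -/
theorem isBrouwerDegree_leraySchauderDegree {δ : ℝ} (ho : IsOpen Ω)
    (hb : Bornology.IsBounded Ω) (hT : ContinuousOn T (closure Ω))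
    (hc : IsCompact (closure (T '' closure Ω))) (hδ : 0 < δ)
    (hp : ∀ x ∈ frontier Ω, δ ≤ ‖x - T x - p‖) {V : Submodule ℝ E} (hV : FiniteDimensional ℝ V)
    (hpV : p ∈ V) {T' : E → V} (hT' : ContinuousOn T' (closure Ω))
    (hT'T : ∀ x ∈ closure Ω, ‖(T' x : E) - T x‖ < δ) :
    IsBrouwerDegree (fun v : V => v - T' (v : E)) {v : V | (v : E) ∈ Ω} ⟨p, hpV⟩
      (leraySchauderDegree (fun x => x - T x) Ω p) := by
  have hne : ∀ x ∈ frontier Ω, x - T x ≠ p := fun x hx h0 => by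
    have := hp x hx
    rw [h0, sub_self, norm_zero] at this
    linarith
  obtain ⟨d, hd⟩ := exists_forall_isBrouwerDegree ho hb hT hc hδ hp
  have hd' : IsLeraySchauderDegree (fun x => x - T x) Ω p d := by
    refine ⟨δ, hδ, fun V hV hpV T' hT' hT'S => hd V hV hpV T' hT' fun x hx => ?_⟩
    simpa only [sub_sub_sub_cancel_left, norm_sub_rev] using hT'S x hx
  rw [(existsUnique_isLeraySchauderDegree ho hb hT hc hne).unique
    (isLeraySchauderDegree_leraySchauderDegree ho hb hT hc hne) hd']
  exact hd V hV hpV T' hT' hT'T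

/-- Homotopy invariance of the Leray–Schauder degree. -/
theorem leraySchauderDegree_eq_of_isPreconnected {Λ : Type*} [TopologicalSpace Λ] {H : Λ → E → E}
    {s : Set Λ} (hs : IsPreconnected s) (ho : IsOpen Ω) (hb : Bornology.IsBounded Ω)
    (hH : ContinuousOn (Function.uncurry H) (s ×ˢ closure Ω))
    (hc : IsCompact (closure (Function.uncurry H '' (s ×ˢ closure Ω))))
    (hp : ∀ a ∈ s, ∀ x ∈ frontier Ω, x - H a x ≠ p) {a b : Λ} (ha : a ∈ s) (hb' : b ∈ s) :
    leraySchauderDegree (fun x => x - H a x) Ω p = leraySchauderDegree (fun x => x - H b x) Ω p := by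
  refine hs.constant (f := fun c => leraySchauderDegree (fun x => x - H c x) Ω p) ?_ ha hb'
  intro a ha
  have hHc : ∀ c ∈ s, ContinuousOn (H c) (closure Ω) := fun c hc =>
    hH.comp (by fun_prop : Continuous fun x : E => (c, x)).continuousOn fun x hx => ⟨hc, hx⟩
  have hcc : ∀ c ∈ s, IsCompact (closure (H c '' closure Ω)) := fun c hcs =>
    hc.of_isClosed_subset isClosed_closure (closure_mono (by
      rintro _ ⟨x, hx, rfl⟩
      exact ⟨(c, x), ⟨hcs, hx⟩, rfl⟩))
  obtain ⟨δ, hδ, hev⟩ := exists_eventually_forall_le_norm_sub isClosed_frontier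
    frontier_subset_closure hH hc ha (hp a ha)
  -- One approximation for all parameters. As `closure Ω` need not be compact, `H c` may fail to
  -- approach `H a` uniformly on it; in `V` the closure `K` is compact and `T' (c, ·)` does converge
  -- uniformly.
  obtain ⟨V, hV, hpV, T', hT', hT'H⟩ := exists_finiteDimensional_approx hH hc p hδ
  have hproper : ProperSpace V := FiniteDimensional.proper ℝ V
  let K : Set V := closure {v : V | (v : E) ∈ Ω}
  have hK : IsCompact K := (isBounded_preimage_coe V hb).isCompact_closure
  have hT'K : ContinuousOn (Function.uncurry fun (c : Λ) (v : V) => T' (c, (v : E))) (s ×ˢ K) :=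
    hT'.comp (by fun_prop) fun q hq => ⟨hq.1, coe_mem_closure V hq.2⟩
  have hT'c : ∀ c ∈ s, ContinuousOn (fun x => T' (c, x)) (closure Ω) := fun c hc =>
    hT'.comp (by fun_prop : Continuous fun x : E => (c, x)).continuousOn fun x hx => ⟨hc, hx⟩
  have hspec : ∀ c ∈ s, (∀ x ∈ frontier Ω, δ ≤ ‖x - H c x - p‖) →
      IsBrouwerDegree (fun v : V => v - T' (c, (v : E))) {v : V | (v : E) ∈ Ω} ⟨p, hpV⟩
        (leraySchauderDegree (fun x => x - H c x) Ω p) := fun c hc hδc =>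
    isBrouwerDegree_leraySchauderDegree (T' := fun x => T' (c, x)) ho hb (hHc c hc) (hcc c hc) hδ
      hδc hV hpV (hT'c c hc) fun x hx => hT'H (c, x) ⟨hc, hx⟩
  have hδa := hev.self_of_nhdsWithin ha
  have hne : ∀ v ∈ frontier {v : V | (v : E) ∈ Ω}, v - T' (a, (v : E)) ≠ ⟨p, hpV⟩ := by
    intro v hv hvp
    have hv' := coe_mem_frontier V hv
    have h1 := hT'H (a, (v : E)) ⟨ha, frontier_subset_closure hv'⟩
    have h2 := hδa v hv'
    have h3 : (v : E) - T' (a, (v : E)) = p := congrArg Subtype.val hvp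
    rw [← h3, sub_sub_sub_cancel_left] at h2
    exact absurd h2 (not_le.2 h1)
  obtain ⟨m, hm, hmne⟩ : ∃ m > 0, ∀ v ∈ frontier {v : V | (v : E) ∈ Ω},
      m ≤ ‖v - T' (a, (v : E)) - ⟨p, hpV⟩‖ := by
    have hcont : ContinuousOn (fun v : V => T' (a, (v : E))) K :=
      (hT'c a ha).comp continuous_subtype_val.continuousOn fun v hv => coe_mem_closure V hv
    exact exists_forall_le_norm_sub isClosed_frontier frontier_subset_closure hcont
      (hK.image_of_continuousOn hcont).closure hne
  obtain ⟨N, hN, hNm⟩ := hK.mem_uniformity_of_prod hT'K ha (Metric.dist_mem_uniformity hm)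
  refine tendsto_nhds_of_eventually_eq ?_
  filter_upwards [hev, hN, self_mem_nhdsWithin] with c hδc hcN hcs
  have h1 := (hspec a ha hδa).of_segment (ho.preimage continuous_subtype_val)
    (isBounded_preimage_coe V hb) (continuousOn_sub_restrict (hT'c a ha))
    (continuousOn_sub_restrict (hT'c c hcs)) (fun t ht v hv hvp => by
      have h2 := hmne v hv
      have h3 : ‖T' (c, (v : E)) - T' (a, (v : E))‖ < m := by
        simpa [dist_eq_norm] using hNm c hcN v (frontier_subset_closure hv)
      rw [← hvp] at h2
      have e : v - T' (a, (v : E)) - (v - T' (a, (v : E)) +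
          t • (v - T' (c, (v : E)) - (v - T' (a, (v : E))))) =
          t • (T' (c, (v : E)) - T' (a, (v : E))) := by module
      rw [e, norm_smul, Real.norm_of_nonneg ht.1] at h2
      have := mul_le_of_le_one_left (norm_nonneg (T' (c, (v : E)) - T' (a, (v : E)))) ht.2
      linarith)
  exact ((h1.unique (continuousOn_sub_restrict (hT'c c hcs)) (hspec c hcs hδc))).symm

/-- Excision for the Leray–Schauder degree. -/
theorem leraySchauderDegree_excision (ho : IsOpen Ω) (ho' : IsOpen Ω') (hb : Bornology.IsBounded Ω)
    (hsub : Ω' ⊆ Ω) (hT : ContinuousOn T (closure Ω)) (hc : IsCompact (closure (T '' closure Ω)))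
    (hp : ∀ x ∈ closure Ω, x ∉ Ω' → x - T x ≠ p) :
    leraySchauderDegree (fun x => x - T x) Ω p = leraySchauderDegree (fun x => x - T x) Ω' p := by
  -- The set `closure Ω \ Ω'` contains both boundaries, so the same `δ`, `V` and `T'` compute both
  -- degrees.
  obtain ⟨δ, hδ, hδp⟩ := exists_forall_le_norm_sub (A := closure Ω \ Ω') (p := p)
    (isClosed_closure.sdiff ho') Set.sdiff_subset hT hc (fun x hx => hp x hx.1 hx.2)
  obtain ⟨V, hV, hpV, T', hT', hT'T⟩ := exists_finiteDimensional_approx hT hc p hδ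
  have hcl := closure_mono hsub
  have h1 := isBrouwerDegree_leraySchauderDegree ho hb hT hc hδ
    (fun x hx => hδp x ⟨frontier_subset_closure hx, fun hx' => (ho.frontier_eq ▸ hx).2 (hsub hx')⟩)
    hV hpV hT' hT'T
  have h2 := isBrouwerDegree_leraySchauderDegree ho' (hb.subset hsub) (hT.mono hcl)
    (hc.of_isClosed_subset isClosed_closure (closure_mono (Set.image_mono hcl))) hδ
    (fun x hx => hδp x ⟨hcl (frontier_subset_closure hx), (ho'.frontier_eq ▸ hx).2⟩)
    hV hpV (hT'.mono hcl) (fun x hx => hT'T x (hcl hx))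
  have h3 := h1.excision (Ω' := {v : V | (v : E) ∈ Ω'}) (ho'.preimage continuous_subtype_val)
    (isBounded_preimage_coe V hb) (fun v hv => hsub hv) (continuousOn_sub_restrict hT')
    (fun v hv hv' hvp => by
      have h4 := hδp v ⟨coe_mem_closure V hv, hv'⟩
      have h5 := hT'T v (coe_mem_closure V hv)
      have h6 : (v : E) - T' (v : E) = p := congrArg Subtype.val hvp
      rw [← h6, sub_sub_sub_cancel_left] at h4
      exact absurd h4 (not_le.2 h5))
  exact h3.unique (continuousOn_sub_restrict (hT'.mono hcl)) h2

end LeraySchauder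

/-! ### Degrees of product maps. -/

theorem LinearMap.det_pi_comp_proj {K : Type*} [Field K] {k : ℕ} {V : Fin k → Type*}
    [∀ i, AddCommGroup (V i)] [∀ i, Module K (V i)] [∀ i, FiniteDimensional K (V i)]
    (f : ∀ i, V i →ₗ[K] V i) :
    LinearMap.det (LinearMap.pi fun i => f i ∘ₗ LinearMap.proj i) = ∏ i, LinearMap.det (f i) := by
  classical
  let b := fun i => Module.finBasis K (V i)
  let B := Pi.basis b
  have hM : LinearMap.toMatrix B B (LinearMap.pi fun i => f i ∘ₗ LinearMap.proj i) =
      Matrix.blockDiagonal' fun i => LinearMap.toMatrix (b i) (b i) (f i) := by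
    ext ⟨i, a⟩ ⟨j, c⟩
    rw [LinearMap.toMatrix_apply, Pi.basis_repr, Pi.basis_apply]
    simp only [LinearMap.pi_apply, LinearMap.comp_apply, LinearMap.proj_apply]
    by_cases h : i = j
    · subst h
      simp [Matrix.blockDiagonal'_apply_eq, LinearMap.toMatrix_apply]
    · simp [Matrix.blockDiagonal'_apply_ne _ _ _ h, Pi.single_eq_of_ne h]
  rw [← LinearMap.det_toMatrix B, hM,
    (Matrix.blockTriangular_blockDiagonal' _).det_fintype]
  refine Finset.prod_congr rfl fun i _ => ?_
  rw [← LinearMap.det_toMatrix (b i), ← Matrix.det_submatrix_equiv_self (Equiv.sigmaSubtype i).symm]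
  congr 1
  ext a c
  simp [Matrix.toSquareBlock_def, Equiv.sigmaSubtype, Matrix.blockDiagonal'_apply_eq]

theorem IsBrouwerDegree.conj {V W : Type*} [NormedAddCommGroup V] [NormedSpace ℝ V]
    [NormedAddCommGroup W] [NormedSpace ℝ W] (e : V ≃L[ℝ] W) {f : V → V} {Ω : Set V} {p : V} {d : ℤ}
    (h : IsBrouwerDegree f Ω p d) :
    IsBrouwerDegree (fun y => e (f (e.symm y))) (e.symm ⁻¹' Ω) (e p) d := by
  obtain ⟨ε, hε, H⟩ := h
  refine ⟨ε / (‖(e.symm : W →L[ℝ] V)‖ + 1), by positivity, fun g hg hgf hreg => ?_⟩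
  have hconj : (fun y => e (e.symm (g (e (e.symm y))))) = g := by
    funext y
    simp
  have h1 := isRegularValueOn_conj e (g := fun x => e.symm (g (e x))) (Ω := Ω) (p := p)
  have h2 := signedCount_conj e (fun x => e.symm (g (e x))) Ω p
  rw [hconj] at h1 h2
  rw [h2]
  refine H _ (by fun_prop) (fun x hx => ?_) (h1.1 hreg)
  have hx' : e x ∈ closure (e.symm ⁻¹' Ω) := by
    have : closure (e.symm ⁻¹' Ω) = e.symm ⁻¹' closure Ω :=
      (e.symm.toHomeomorph.preimage_closure Ω).symm
    rw [this]
    simpa using hx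
  have h3 := hgf (e x) hx'
  simp only [e.symm_apply_apply] at h3
  have h4 : e.symm (g (e x)) - f x = (e.symm : W →L[ℝ] V) (g (e x) - e (f x)) := by simp
  rw [h4]
  have hpos : 0 < ‖(e.symm : W →L[ℝ] V)‖ + 1 := by positivity
  calc ‖(e.symm : W →L[ℝ] V) (g (e x) - e (f x))‖
      ≤ ‖(e.symm : W →L[ℝ] V)‖ * ‖g (e x) - e (f x)‖ := ContinuousLinearMap.le_opNorm _ _
    _ ≤ (‖(e.symm : W →L[ℝ] V)‖ + 1) * ‖g (e x) - e (f x)‖ := by gcongr; linarith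
    _ < ε := by
      rw [lt_div_iff₀ hpos] at h3
      linarith

section Product
variable {k : ℕ} {V : Fin k → Type*} [∀ i, NormedAddCommGroup (V i)] [∀ i, NormedSpace ℝ (V i)]
  [∀ i, FiniteDimensional ℝ (V i)]

theorem det_fderiv_pi {g : ∀ i, V i → V i} (hg : ∀ i, ContDiff ℝ ∞ (g i)) (x : ∀ i, V i) :
    (fderiv ℝ (fun (y : ∀ i, V i) i => g i (y i)) x).det = ∏ i, (fderiv ℝ (g i) (x i)).det := by
  have h : HasFDerivAt (fun (y : ∀ i, V i) i => g i (y i))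
      (ContinuousLinearMap.pi fun i => (fderiv ℝ (g i) (x i)).comp (ContinuousLinearMap.proj i))
      x := by
    rw [hasFDerivAt_pi]
    exact fun i => ((hg i).differentiable (by simp) (x i)).hasFDerivAt.comp x
      (ContinuousLinearMap.proj (R := ℝ) (φ := V) i).hasFDerivAt
  rw [h.fderiv]
  exact LinearMap.det_pi_comp_proj fun i => (fderiv ℝ (g i) (x i) : V i →ₗ[ℝ] V i)

theorem signedCount_pi {g : ∀ i, V i → V i} (hg : ∀ i, ContDiff ℝ ∞ (g i)) {Ω : ∀ i, Set (V i)}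
    {p : ∀ i, V i} (hfin : ∀ i, {x | x ∈ Ω i ∧ g i x = p i}.Finite) :
    signedCount (fun (y : ∀ i, V i) i => g i (y i)) (Set.univ.pi Ω) p =
      ∏ i, signedCount (g i) (Ω i) (p i) := by
  classical
  have hset : {x | x ∈ Set.univ.pi Ω ∧ (fun (y : ∀ i, V i) i => g i (y i)) x = p} =
      (Fintype.piFinset fun i => (hfin i).toFinset : Finset (∀ i, V i)) := by
    ext x
    simp [Set.mem_pi, funext_iff, forall_and]
  rw [signedCount, hset, finsum_mem_coe_finset]
  simp only [signedCount, fun i => finsum_mem_eq_finite_toFinset_sum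
    (fun x => ((SignType.sign (fderiv ℝ (g i) x).det : SignType) : ℤ)) (hfin i)]
  rw [Finset.prod_univ_sum]
  refine Finset.sum_congr rfl fun x _ => ?_
  rw [det_fderiv_pi hg]
  exact map_prod ((SignType.castHom (α := ℤ)).comp (signHom (α := ℝ))) _ _

/-- The Brouwer degree of a product map is the product of the degrees. -/
theorem IsBrouwerDegree.pi {f : ∀ i, V i → V i} {Ω : ∀ i, Set (V i)} {p : ∀ i, V i}
    (ho : ∀ i, IsOpen (Ω i)) (hb : ∀ i, Bornology.IsBounded (Ω i))
    (hf : ∀ i, ContinuousOn (f i) (closure (Ω i))) (hp : ∀ i, ∀ x ∈ frontier (Ω i), f i x ≠ p i)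
    {d : Fin k → ℤ} (hd : ∀ i, IsBrouwerDegree (f i) (Ω i) (p i) (d i)) :
    IsBrouwerDegree (fun (y : ∀ i, V i) i => f i (y i)) (Set.univ.pi Ω) p (∏ i, d i) := by
  have hproper : ∀ i, ProperSpace (V i) := fun i => FiniteDimensional.proper ℝ (V i)
  have hcont : ContinuousOn (fun (y : ∀ i, V i) i => f i (y i)) (closure (Set.univ.pi Ω)) := by
    rw [closure_pi_set, continuousOn_pi]
    exact fun i => (hf i).comp (continuous_apply i).continuousOn fun y hy => hy i trivial
  have hfront : ∀ y ∈ frontier (Set.univ.pi Ω), (fun i => f i (y i)) ≠ p := by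
    intro y hy hyp
    have hy1 := frontier_subset_closure hy
    rw [closure_pi_set] at hy1
    refine ((isOpen_set_pi Set.finite_univ fun i _ => ho i).frontier_eq ▸ hy).2 fun i _ => ?_
    by_contra hyi
    exact hp i (y i) ((ho i).frontier_eq ▸ ⟨hy1 i trivial, hyi⟩) (congrFun hyp i)
  -- A degree `D` exists in any case, so one product of regular approximations identifies it. An
  -- arbitrary approximation of the product map need not split.
  obtain ⟨D, hD⟩ := exists_isBrouwerDegree (isOpen_set_pi Set.finite_univ fun i _ => ho i)
    (Bornology.IsBounded.pi hb) hcont hfront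
  obtain ⟨ε, hε, H⟩ := id hD
  choose ε' hε' H' using hd
  have hm : ∀ i, ∃ m > 0, ∀ x ∈ frontier (Ω i), m ≤ ‖f i x - p i‖ := by
    intro i
    have hc : ContinuousOn (fun x => x - f i x) (closure (Ω i)) := continuousOn_id.sub (hf i)
    obtain ⟨m, hm, h⟩ := exists_forall_le_norm_sub (T := fun x => x - f i x) (p := p i)
      isClosed_frontier frontier_subset_closure hc
      ((hb i).isCompact_closure.image_of_continuousOn hc).closure
      (fun x hx => by simpa only [sub_sub_cancel] using hp i x hx)
    exact ⟨m, hm, fun x hx => by simpa only [sub_sub_cancel] using h x hx⟩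
  choose m hm hmp using hm
  -- The bound `ε` is for the product map, `ε' i` for the factor, and `m i` keeps solutions off the
  -- boundary so that they are finite in number.
  choose g hg hgf hreg using fun i => exists_contDiff_approx_on_regular isClosed_closure (hf i) (p i)
    (lt_min hε (lt_min (hε' i) (hm i)))
  have hsol : ∀ i, ∀ x ∈ closure (Ω i), g i x = p i → x ∈ Ω i := by
    intro i x hx hxp
    by_contra hxΩ
    have h1 := hmp i x ((ho i).frontier_eq ▸ ⟨hx, hxΩ⟩)
    have h2 := (hgf i x hx).trans_le ((min_le_right _ _).trans (min_le_right _ _))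
    rw [hxp, norm_sub_rev] at h2
    linarith
  have hcount := signedCount_pi hg (Ω := Ω) (p := p) fun i =>
    (hreg i (Ω i)).finite_preimage (hg i) (hb i) (hsol i)
  have h1 := H (fun y i => g i (y i)) (contDiff_pi.2 fun i => (hg i).comp
    (ContinuousLinearMap.proj (R := ℝ) (φ := V) i).contDiff) (fun y hy => by
    rw [closure_pi_set] at hy
    refine (pi_norm_lt_iff hε).2 fun i => ?_
    exact (hgf i (y i) (hy i trivial)).trans_le (min_le_left _ _)) (fun y _ hyp => by
    rw [det_fderiv_pi hg, Finset.prod_ne_zero_iff]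
    exact fun i _ => hreg i Set.univ (y i) trivial (congrFun hyp i))
  rw [hcount] at h1
  have h2 : ∀ i, signedCount (g i) (Ω i) (p i) = d i := fun i =>
    H' i (g i) (hg i) (fun x hx => (hgf i x hx).trans_le
      ((min_le_right _ _).trans (min_le_left _ _))) (hreg i _)
  simp only [h2] at h1
  rwa [h1]

end Product

/-- Membership in the frontier of a product of open sets. -/
theorem exists_mem_frontier_of_mem_frontier_pi {ι : Type*} [Finite ι] {X : ι → Type*}
    [∀ i, TopologicalSpace (X i)] {Ω : ∀ i, Set (X i)} (ho : ∀ i, IsOpen (Ω i)) {x : ∀ i, X i}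
    (hx : x ∈ frontier (Set.univ.pi Ω)) : (∀ i, x i ∈ closure (Ω i)) ∧ ∃ i, x i ∈ frontier (Ω i) := by
  have hx1 := frontier_subset_closure hx
  rw [closure_pi_set] at hx1
  refine ⟨fun i => hx1 i trivial, ?_⟩
  by_contra! hcon
  refine ((isOpen_set_pi Set.finite_univ fun i _ => ho i).frontier_eq ▸ hx).2 fun i _ => ?_
  by_contra hxi
  exact hcon i ((ho i).frontier_eq ▸ ⟨hx1 i trivial, hxi⟩)

theorem isCompact_closure_image_pi {ι X : Type*} {Y : ι → Type*} [∀ i, TopologicalSpace (Y i)]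
    [∀ i, T2Space (Y i)] {T : ∀ i, X → Y i} {A : Set X}
    (hc : ∀ i, IsCompact (closure (T i '' A))) : IsCompact (closure ((fun x i => T i x) '' A)) := by
  refine (isCompact_univ_pi hc).of_isClosed_subset isClosed_closure
    (closure_minimal ?_ (isCompact_univ_pi hc).isClosed)
  rintro _ ⟨x, hx, rfl⟩ i -
  exact subset_closure ⟨x, hx, rfl⟩

/-- The Leray–Schauder degree of a product map is the product of the degrees. -/
theorem leraySchauderDegree_pi {k : ℕ} {E : Fin k → Type*} [∀ i, NormedAddCommGroup (E i)]
    [∀ i, NormedSpace ℝ (E i)] {T : ∀ i, E i → E i} {Ω : ∀ i, Set (E i)} {p : ∀ i, E i}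
    (ho : ∀ i, IsOpen (Ω i)) (hb : ∀ i, Bornology.IsBounded (Ω i))
    (hT : ∀ i, ContinuousOn (T i) (closure (Ω i)))
    (hc : ∀ i, IsCompact (closure (T i '' closure (Ω i))))
    (hp : ∀ i, ∀ x ∈ frontier (Ω i), x - T i x ≠ p i) :
    leraySchauderDegree (fun x : ∀ i, E i => x - fun i => T i (x i)) (Set.univ.pi Ω) p =
      ∏ i, leraySchauderDegree (fun x => x - T i x) (Ω i) (p i) := by
  have hcl : closure (Set.univ.pi Ω) = Set.univ.pi fun i => closure (Ω i) := closure_pi_set _ _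
  choose δ' hδ' hδp' using fun i => exists_forall_le_norm_sub isClosed_frontier
    frontier_subset_closure (hT i) (hc i) (hp i)
  -- Taken from a filter rather than as a minimum, which also covers `k = 0`.
  obtain ⟨δ, hδ, hδle⟩ : ∃ δ > 0, ∀ i, δ ≤ δ' i := by
    have h1 : ∀ᶠ δ in 𝓝[>] (0 : ℝ), ∀ i, δ ≤ δ' i :=
      Filter.eventually_all.2 fun i => nhdsWithin_le_nhds (Iic_mem_nhds (hδ' i))
    obtain ⟨δ, h2, h3⟩ := (h1.and self_mem_nhdsWithin).exists
    exact ⟨δ, h3, h2⟩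
  have hδp : ∀ i, ∀ x ∈ frontier (Ω i), δ ≤ ‖x - T i x - p i‖ := fun i x hx =>
    (hδle i).trans (hδp' i x hx)
  choose V hV hpV T' hT' hT'T using fun i => exists_finiteDimensional_approx (hT i) (hc i) (p i) hδ
  have hd := fun i => isBrouwerDegree_leraySchauderDegree (ho i) (hb i) (hT i) (hc i) hδ (hδp i)
    (hV i) (hpV i) (hT' i) (hT'T i)
  have hTc : ContinuousOn (fun (x : ∀ i, E i) i => T i (x i)) (closure (Set.univ.pi Ω)) := by
    rw [hcl, continuousOn_pi]
    exact fun i => (hT i).comp (continuous_apply i).continuousOn fun y hy => hy i trivial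
  have hcc : IsCompact (closure ((fun (x : ∀ i, E i) i => T i (x i)) ''
      closure (Set.univ.pi Ω))) := by
    refine isCompact_closure_image_pi fun i => (hc i).of_isClosed_subset isClosed_closure
      (closure_mono ?_)
    rw [hcl]
    rintro _ ⟨x, hx, rfl⟩
    exact ⟨x i, hx i trivial, rfl⟩
  have hδpi : ∀ x ∈ frontier (Set.univ.pi Ω), δ ≤ ‖x - (fun i => T i (x i)) - p‖ := by
    intro x hx
    obtain ⟨-, i, hi⟩ := exists_mem_frontier_of_mem_frontier_pi ho hx
    exact (hδp i (x i) hi).trans (norm_le_pi_norm (x - (fun i => T i (x i)) - p) i)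
  let W : Submodule ℝ (∀ i, E i) := Submodule.pi Set.univ V
  let e₀ : (∀ i, V i) ≃ₗ[ℝ] W :=
    { toFun := fun v => ⟨fun i => v i, fun i _ => (v i).2⟩
      invFun := fun w i => ⟨(w : ∀ i, E i) i, w.2 i trivial⟩
      map_add' := fun _ _ => rfl
      map_smul' := fun _ _ => rfl
      left_inv := fun _ => rfl
      right_inv := fun _ => rfl }
  have hW : FiniteDimensional ℝ W := e₀.finiteDimensional
  let e : (∀ i, V i) ≃L[ℝ] W := e₀.toContinuousLinearEquiv
  let T'' : (∀ i, E i) → W := fun x => e fun i => T' i (x i)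
  have hT'' : ContinuousOn T'' (closure (Set.univ.pi Ω)) := by
    refine e.continuous.comp_continuousOn ?_
    rw [hcl, continuousOn_pi]
    exact fun i => (hT' i).comp (continuous_apply i).continuousOn fun y hy => hy i trivial
  have h1 := isBrouwerDegree_leraySchauderDegree
    (isOpen_set_pi Set.finite_univ fun i _ => ho i) (Bornology.IsBounded.pi hb) hTc hcc hδ hδpi
    hW (fun i _ => hpV i) hT'' (fun x hx => by
      rw [hcl] at hx
      exact (pi_norm_lt_iff hδ).2 fun i => hT'T i (x i) (hx i trivial))
  have h2 := (IsBrouwerDegree.pi (V := fun i => V i) (p := fun i => ⟨p i, hpV i⟩)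
    (fun i => (ho i).preimage continuous_subtype_val)
    (fun i => isBounded_preimage_coe (V i) (hb i)) (fun i => continuousOn_sub_restrict (hT' i))
    (fun i v hv hvp => by
      have hv' := coe_mem_frontier _ hv
      have h3 := hδp i v hv'
      have h4 : (v : E i) - T' i (v : E i) = p i := congrArg Subtype.val hvp
      rw [← h4, sub_sub_sub_cancel_left] at h3
      exact absurd h3 (not_le.2 (hT'T i v (frontier_subset_closure hv')))) hd).conj e
  exact h1.unique (continuousOn_sub_restrict hT'') h2

/-! ### Freezing the variables of a system along contractions. -/

section Systems
variable {k : ℕ} {E : Fin k → Type*} [∀ i, NormedAddCommGroup (E i)]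

/-- A family of compact maps on the closure of a product of open sets such that the solutions of the
`i`-th equation `x i - T i x = p i` have their `i`-th coordinate off the boundary. -/
structure IsAdmissibleFamily (Ω : ∀ i, Set (E i)) (T : ∀ i, (∀ j, E j) → E i) (p : ∀ i, E i) :
    Prop where
  continuousOn : ∀ i, ContinuousOn (T i) (Set.univ.pi fun j => closure (Ω j))
  isCompact : ∀ i, IsCompact (closure (T i '' Set.univ.pi fun j => closure (Ω j)))
  mem : ∀ i, ∀ x ∈ Set.univ.pi fun j => closure (Ω j), x i - T i x = p i → x i ∈ Ω i

/-- The family obtained from `T` by freezing in the `a`-th map all the variables except the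
`a`-th one. -/
def freezeComponent (T : ∀ i, (∀ j, E j) → E i) (a : Fin k) (y : ∀ j, E j) :
    ∀ i, (∀ j, E j) → E i :=
  Function.update T a fun x => T a (Function.update y a (x a))

variable {Ω : ∀ i, Set (E i)} {T : ∀ i, (∀ j, E j) → E i} {p : ∀ i, E i}

theorem update_mem_pi_closure {y x : ∀ j, E j} (hy : y ∈ Set.univ.pi fun j => closure (Ω j))
    (hx : x ∈ Set.univ.pi fun j => closure (Ω j)) (a : Fin k) :
    Function.update y a (x a) ∈ Set.univ.pi fun j => closure (Ω j) := by
  intro j _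
  rcases eq_or_ne j a with rfl | h
  · simpa using hx j trivial
  · simpa [h] using hy j trivial

theorem pi_subset_pi_closure : Set.univ.pi Ω ⊆ Set.univ.pi fun j => closure (Ω j) :=
  Set.pi_mono fun _ _ => subset_closure

/-- The new `a`-th map is `T a` at a point of the closed product with the same `a`-th coordinate, so
all three conditions are inherited. This permits freezing the components one after another. -/
theorem IsAdmissibleFamily.freeze (h : IsAdmissibleFamily Ω T p) (a : Fin k)
    {y : ∀ j, E j} (hy : y ∈ Set.univ.pi fun j => closure (Ω j)) :
    IsAdmissibleFamily Ω (freezeComponent T a y) p := by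
  refine ⟨fun i => ?_, fun i => ?_, fun i x hx hxp => ?_⟩ <;> rcases eq_or_ne i a with rfl | hi
  · simp only [freezeComponent, Function.update_self]
    exact (h.continuousOn i).comp (by fun_prop) fun x hx => update_mem_pi_closure hy hx i
  · simpa [freezeComponent, hi] using h.continuousOn i
  · simp only [freezeComponent, Function.update_self]
    refine (h.isCompact i).of_isClosed_subset isClosed_closure (closure_mono ?_)
    rintro _ ⟨x, hx, rfl⟩
    exact ⟨_, update_mem_pi_closure hy hx i, rfl⟩
  · simpa [freezeComponent, hi] using h.isCompact i
  · simp only [freezeComponent, Function.update_self] at hxp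
    simpa using h.mem i _ (update_mem_pi_closure hy hx i) (by simpa using hxp)
  · exact h.mem i x hx (by simpa [freezeComponent, hi] using hxp)

/-- A contraction of `Ω` to a point, extended by the identity. -/
theorem exists_contraction {X : Type*} [TopologicalSpace X] (s : Set X) [ContractibleSpace s] :
    ∃ y ∈ s, ∃ h : unitInterval → X → X, ContinuousOn (Function.uncurry h) (Set.univ ×ˢ s) ∧
      (∀ t, Set.MapsTo (h t) s s) ∧ (∀ x ∈ s, h 0 x = x) ∧ ∀ x ∈ s, h 1 x = y := by
  classical
  obtain ⟨y, ⟨F⟩⟩ := id_nullhomotopic s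
  let h : unitInterval → X → X := fun t x => if hx : x ∈ s then (F (t, ⟨x, hx⟩) : X) else x
  have hh : ∀ t x (hx : x ∈ s), h t x = (F (t, ⟨x, hx⟩) : X) := fun t x hx => dif_pos hx
  refine ⟨y, y.2, h, ?_, fun t x hx => ?_, fun x hx => ?_, fun x hx => ?_⟩
  · rw [continuousOn_iff_continuous_domRestrict]
    have : (Set.univ ×ˢ s).domRestrict (Function.uncurry h) =
        fun q : (Set.univ ×ˢ s : Set (unitInterval × X)) => (F (q.1.1, ⟨q.1.2, q.2.2⟩) : X) := by
      funext q
      exact hh _ _ q.2.2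
    rw [this]
    fun_prop
  · rw [hh t x hx]
    exact Subtype.coe_prop _
  · rw [hh 0 x hx]
    simp
  · rw [hh 1 x hx]
    simp

theorem IsAdmissibleFamily.continuousOn_pi (h : IsAdmissibleFamily Ω T p) :
    ContinuousOn (fun x i => T i x) (closure (Set.univ.pi Ω)) := by
  rw [closure_pi_set]
  exact _root_.continuousOn_pi.2 h.continuousOn

theorem IsAdmissibleFamily.isCompact_pi (h : IsAdmissibleFamily Ω T p) :
    IsCompact (closure ((fun x i => T i x) '' closure (Set.univ.pi Ω))) := by
  rw [closure_pi_set]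
  exact isCompact_closure_image_pi h.isCompact

theorem IsAdmissibleFamily.mem_pi (h : IsAdmissibleFamily Ω T p) {x : ∀ i, E i}
    (hx : x ∈ closure (Set.univ.pi Ω)) (hxp : (x - fun i => T i x) = p) : x ∈ Set.univ.pi Ω := by
  rw [closure_pi_set] at hx
  exact fun i _ => h.mem i x hx (congrFun hxp i)

variable [∀ i, NormedSpace ℝ (E i)]

/-- Freezing variables in one of the maps along contractions does not change the degree. -/
theorem IsAdmissibleFamily.leraySchauderDegree_freeze (h : IsAdmissibleFamily Ω T p)
    (ho : ∀ i, IsOpen (Ω i)) (hb : ∀ i, Bornology.IsBounded (Ω i)) (a : Fin k)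
    {y : ∀ j, E j} (hy : y ∈ Set.univ.pi Ω) {c : ∀ j, unitInterval → E j → E j}
    (hc : ∀ j, ContinuousOn (Function.uncurry (c j)) (Set.univ ×ˢ Ω j))
    (hcΩ : ∀ j t, Set.MapsTo (c j t) (Ω j) (Ω j)) (hc0 : ∀ j, ∀ x ∈ Ω j, c j 0 x = x)
    (hc1 : ∀ j, ∀ x ∈ Ω j, c j 1 x = y j) :
    leraySchauderDegree (fun x : ∀ j, E j => x - fun i => freezeComponent T a y i x)
      (Set.univ.pi Ω) p =
    leraySchauderDegree (fun x : ∀ j, E j => x - fun i => T i x) (Set.univ.pi Ω) p := by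
  have hopen : IsOpen (Set.univ.pi Ω) := isOpen_set_pi Set.finite_univ fun i _ => ho i
  have hbdd : Bornology.IsBounded (Set.univ.pi Ω) := Bornology.IsBounded.pi hb
  have h' := h.freeze a (pi_subset_pi_closure hy)
  -- Every coordinate but the `a`-th moves. The `a`-th one may therefore lie in the closure, where
  -- its contraction need not be continuous.
  let γ : unitInterval → (∀ j, E j) → ∀ j, E j := fun t x =>
    Function.update (fun j => c j t (x j)) a (x a)
  let H : unitInterval → (∀ j, E j) → ∀ j, E j := fun t x =>
    Function.update (fun i => T i x) a (T a (γ t x))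
  have hγa : ∀ t x, γ t x a = x a := fun t x => Function.update_self ..
  have hHa : ∀ t x, H t x a = T a (γ t x) := fun t x => Function.update_self ..
  have hHi : ∀ t x i, i ≠ a → H t x i = T i x := fun t x i hi => Function.update_of_ne hi ..
  have hγmem : ∀ t x, x a ∈ closure (Ω a) → (∀ j, j ≠ a → x j ∈ Ω j) →
      γ t x ∈ Set.univ.pi fun j => closure (Ω j) := by
    intro t x hxa hx j _
    rcases eq_or_ne j a with rfl | hj
    · simpa [γ] using hxa
    · simpa [γ, hj] using subset_closure (hcΩ j t (hx j hj))
  have hγΩ : ∀ t, ∀ x ∈ Set.univ.pi Ω, γ t x ∈ Set.univ.pi fun j => closure (Ω j) := fun t x hx =>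
    hγmem t x (subset_closure (hx a trivial)) fun j _ => hx j trivial
  have hγtendsto : ∀ (l : Filter (unitInterval × ∀ j, E j)) (t : unitInterval) (z : ∀ j, E j),
      l ≤ 𝓝 (t, z) → (∀ᶠ q in l, q.2 ∈ Set.univ.pi Ω) → (∀ j, j ≠ a → z j ∈ Ω j) →
      Filter.Tendsto (fun q => γ q.1 q.2) l (𝓝 (γ t z)) := by
    intro l t z hl hlΩ hz
    have hl1 : Filter.Tendsto (fun q : unitInterval × ∀ j, E j => q.1) l (𝓝 t) :=
      continuousAt_fst.tendsto.mono_left hl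
    have hl2 : ∀ j, Filter.Tendsto (fun q : unitInterval × ∀ j, E j => q.2 j) l (𝓝 (z j)) :=
      fun j => (((continuous_apply j).comp continuous_snd).tendsto (t, z)).mono_left hl
    rw [tendsto_pi_nhds]
    intro j
    rcases eq_or_ne j a with rfl | hj
    · simpa [γ] using hl2 j
    · simp only [γ, Function.update_of_ne hj]
      refine (hc j (t, z j) ⟨trivial, hz j hj⟩).tendsto.comp
        (tendsto_nhdsWithin_iff.2 ⟨hl1.prodMk_nhds (hl2 j), ?_⟩)
      filter_upwards [hlΩ] with q hq using ⟨trivial, hq j trivial⟩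
  have hγcont : ContinuousOn (Function.uncurry γ) (Set.univ ×ˢ Set.univ.pi Ω) := fun q hq =>
    hγtendsto _ q.1 q.2 inf_le_left (by
      filter_upwards [self_mem_nhdsWithin] with r hr using hr.2) fun j _ => hq.2 j trivial
  have hHcont : ContinuousOn (Function.uncurry H) (Set.univ ×ˢ Set.univ.pi Ω) := by
    rw [_root_.continuousOn_pi]
    intro i
    rcases eq_or_ne i a with rfl | hi
    · have : (fun q => Function.uncurry H q i) = fun q => T i (Function.uncurry γ q) := by
        funext q
        exact hHa q.1 q.2
      rw [this]
      exact (h.continuousOn i).comp hγcont fun q hq => hγΩ q.1 q.2 hq.2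
    · have : (fun q => Function.uncurry H q i) = fun q => T i q.2 := by
        funext q
        exact hHi q.1 q.2 i hi
      rw [this]
      exact (h.continuousOn i).comp continuousOn_snd fun q hq => pi_subset_pi_closure hq.2
  let K : Set (∀ j, E j) := Set.univ.pi fun i =>
    closure (T i '' Set.univ.pi fun j => closure (Ω j))
  have hK : IsCompact K := isCompact_univ_pi h.isCompact
  have hHK : ∀ t, ∀ x ∈ Set.univ.pi Ω, H t x ∈ K := by
    intro t x hx i _
    rcases eq_or_ne i a with rfl | hi
    · rw [hHa]
      exact subset_closure ⟨_, hγΩ t x hx, rfl⟩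
    · rw [hHi t x i hi]
      exact subset_closure ⟨_, pi_subset_pi_closure hx, rfl⟩
  -- The zeros at all times, sought in the open product only, since the deformation need not be
  -- continuous up to its boundary.
  let Z : Set (unitInterval × ∀ j, E j) := {q | q.2 ∈ Set.univ.pi Ω ∧ q.2 - H q.1 q.2 = p}
  have hZ : IsCompact Z := by
    rw [isCompact_iff_ultrafilter_le_nhds]
    intro u hu
    have huZ : ∀ᶠ q in (u : Filter (unitInterval × ∀ j, E j)), q ∈ Z := Filter.le_principal_iff.1 hu
    have huΩ : ∀ᶠ q in (u : Filter (unitInterval × ∀ j, E j)), q.2 ∈ Set.univ.pi Ω :=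
      huZ.mono fun q hq => hq.1
    obtain ⟨t, -, ht⟩ := isCompact_univ.ultrafilter_le_nhds (u.map Prod.fst) (by simp)
    obtain ⟨w, -, hw⟩ := hK.ultrafilter_le_nhds (u.map fun q => H q.1 q.2) (by
      rw [Filter.le_principal_iff]
      change ∀ᶠ q in (u : Filter (unitInterval × ∀ j, E j)), H q.1 q.2 ∈ K
      filter_upwards [huΩ] with q hq using hHK _ _ hq)
    have hw' : Filter.Tendsto (fun q : unitInterval × ∀ j, E j => H q.1 q.2) u (𝓝 w) := hw
    have ht' : Filter.Tendsto (fun q : unitInterval × ∀ j, E j => q.1) u (𝓝 t) := ht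
    have hx : Filter.Tendsto (fun q : unitInterval × ∀ j, E j => q.2) u (𝓝 (p + w)) := by
      refine (hw'.const_add p).congr' ?_
      filter_upwards [huZ] with q hq
      rw [← hq.2, sub_add_cancel]
    set z := p + w with hz
    have huz : (u : Filter (unitInterval × ∀ j, E j)) ≤ 𝓝 (t, z) := by
      exact Filter.tendsto_id'.1 (ht'.prodMk_nhds hx)
    have hxi : ∀ i, Filter.Tendsto (fun q : unitInterval × ∀ j, E j => q.2 i) u (𝓝 (z i)) :=
      fun i => ((continuous_apply i).tendsto z).comp hx
    have hzcl : z ∈ Set.univ.pi fun j => closure (Ω j) := by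
      rw [← closure_pi_set]
      exact mem_closure_of_tendsto hx huΩ
    have hlim : ∀ i v, Filter.Tendsto (fun q : unitInterval × ∀ j, E j => H q.1 q.2 i) u (𝓝 v) →
        z i - v = p i := by
      intro i v hv
      refine tendsto_nhds_unique ((hxi i).sub hv) (tendsto_const_nhds.congr' ?_)
      filter_upwards [huZ] with q hq using (congrFun hq.2 i).symm
    -- These equations do not involve the contractions and hold up to the closure; they put `z i` in
    -- `Ω i`, where the contractions are continuous, and only then can equation `a` pass to the
    -- limit.
    have hTi : ∀ i, i ≠ a → z i - T i z = p i := by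
      intro i hi
      refine hlim i _ ?_
      simp only [fun t x => hHi t x i hi]
      refine (h.continuousOn i z hzcl).tendsto.comp (tendsto_nhdsWithin_iff.2 ⟨hx, ?_⟩)
      filter_upwards [huΩ] with q hq using pi_subset_pi_closure hq
    have hzi : ∀ i, i ≠ a → z i ∈ Ω i := fun i hi => h.mem i z hzcl (hTi i hi)
    have hγz := hγmem t z (hzcl a trivial) hzi
    have hTa : z a - T a (γ t z) = p a := by
      refine hlim a _ ?_
      simp only [hHa]
      refine (h.continuousOn a _ hγz).tendsto.comp
        (tendsto_nhdsWithin_iff.2 ⟨hγtendsto _ t z huz huΩ hzi, ?_⟩)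
      filter_upwards [huΩ] with q hq using hγΩ _ _ hq
    have hza : z a ∈ Ω a := by
      have := h.mem a _ hγz (by rwa [hγa])
      rwa [hγa] at this
    refine ⟨(t, z), ⟨fun i _ => ?_, ?_⟩, huz⟩
    · rcases eq_or_ne i a with rfl | hi
      exacts [hza, hzi i hi]
    · funext i
      rcases eq_or_ne i a with rfl | hi
      · simpa [hHa] using hTa
      · simpa [hHi t z i hi] using hTi i hi
  have hZΩ : Prod.snd '' Z ⊆ Set.univ.pi Ω := by
    rintro _ ⟨q, hq, rfl⟩
    exact hq.1
  obtain ⟨δ, hδ, hδΩ⟩ := (hZ.image continuous_snd).exists_cthickening_subset_open hopen hZΩ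
  set Ω' := Metric.thickening δ (Prod.snd '' Z)
  have hZΩ' : Prod.snd '' Z ⊆ Ω' := Metric.self_subset_thickening hδ _
  have hΩ'cl : closure Ω' ⊆ Set.univ.pi Ω := (Metric.closure_thickening_subset_cthickening _ _).trans hδΩ
  have hΩ'Ω : Ω' ⊆ Set.univ.pi Ω := subset_closure.trans hΩ'cl
  have hΩ'o : IsOpen Ω' := Metric.isOpen_thickening
  have hH0 : ∀ x ∈ Set.univ.pi Ω, H 0 x = fun i => T i x := by
    intro x hx
    have : γ 0 x = x := by
      funext j
      rcases eq_or_ne j a with rfl | hj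
      · simp [γ]
      · simp [γ, hj, hc0 j (x j) (hx j trivial)]
    simp only [H, this, Function.update_eq_self]
  have hH1 : ∀ x ∈ Set.univ.pi Ω, H 1 x = fun i => freezeComponent T a y i x := by
    intro x hx
    have : γ 1 x = Function.update y a (x a) := by
      funext j
      rcases eq_or_ne j a with rfl | hj
      · simp [γ]
      · simp [γ, hj, hc1 j (x j) (hx j trivial)]
    funext i
    rcases eq_or_ne i a with rfl | hi
    · simp [H, freezeComponent, this]
    · simp [H, freezeComponent, hi]
  -- Used at the two ends `t = 0` and `t = 1`, where the deformation agrees on the open product with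
  -- a family that is compact on the closed product, so that excision to `Ω'` makes sense.
  have hexc : ∀ (T' : ∀ i, (∀ j, E j) → E i) (t : unitInterval), IsAdmissibleFamily Ω T' p →
      (∀ x ∈ Set.univ.pi Ω, H t x = fun i => T' i x) →
      leraySchauderDegree (fun x => x - fun i => T' i x) (Set.univ.pi Ω) p =
        leraySchauderDegree (fun x => x - H t x) Ω' p := by
    intro T' t hT' hHt
    rw [leraySchauderDegree_excision (T := fun x i => T' i x) hopen hΩ'o hbdd hΩ'Ω
      hT'.continuousOn_pi hT'.isCompact_pi fun x hx hx' hxp => ?_]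
    · refine leraySchauderDegree_congr fun x hx => ?_
      simp only [hHt x (hΩ'cl hx)]
    · have hxΩ := hT'.mem_pi hx hxp
      refine hx' (hZΩ' ⟨(t, x), ⟨hxΩ, ?_⟩, rfl⟩)
      simp only [hHt x hxΩ]
      exact hxp
  rw [hexc _ 1 h' hH1, hexc _ 0 h hH0]
  refine leraySchauderDegree_eq_of_isPreconnected (s := Set.univ) isPreconnected_univ hΩ'o
    (hbdd.subset hΩ'Ω) (hHcont.mono (Set.prod_mono le_rfl hΩ'cl)) ?_ ?_ trivial trivial
  · refine hK.of_isClosed_subset isClosed_closure (closure_minimal ?_ hK.isClosed)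
    rintro _ ⟨q, hq, rfl⟩
    exact hHK _ _ (hΩ'cl hq.2)
  · intro t _ x hx hxp
    exact (hΩ'o.frontier_eq ▸ hx).2
      (hZΩ' ⟨(t, x), ⟨hΩ'cl (frontier_subset_closure hx), hxp⟩, rfl⟩)

end Systems

section Systems
variable {k : ℕ} {E : Fin k → Type*} [∀ i, NormedAddCommGroup (E i)] [∀ i, NormedSpace ℝ (E i)]
  {Ω : ∀ i, Set (E i)} {T : ∀ i, (∀ j, E j) → E i} {p : ∀ i, E i}

/-- Induction on the set of frozen components. They are frozen one at a time because each
deformation relies on the remaining equations being undeformed. -/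
theorem IsAdmissibleFamily.leraySchauderDegree_freeze_all (h : IsAdmissibleFamily Ω T p)
    (ho : ∀ i, IsOpen (Ω i)) (hb : ∀ i, Bornology.IsBounded (Ω i))
    {y : ∀ j, E j} (hy : y ∈ Set.univ.pi Ω) {c : ∀ j, unitInterval → E j → E j}
    (hc : ∀ j, ContinuousOn (Function.uncurry (c j)) (Set.univ ×ˢ Ω j))
    (hcΩ : ∀ j t, Set.MapsTo (c j t) (Ω j) (Ω j)) (hc0 : ∀ j, ∀ x ∈ Ω j, c j 0 x = x)
    (hc1 : ∀ j, ∀ x ∈ Ω j, c j 1 x = y j) :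
    leraySchauderDegree (fun x : ∀ j, E j => x - fun i => T i (Function.update y i (x i)))
      (Set.univ.pi Ω) p =
    leraySchauderDegree (fun x : ∀ j, E j => x - fun i => T i x) (Set.univ.pi Ω) p := by
  classical
  let F : Finset (Fin k) → ∀ i, (∀ j, E j) → E i := fun A i x =>
    if i ∈ A then T i (Function.update y i (x i)) else T i x
  have key : ∀ A, IsAdmissibleFamily Ω (F A) p ∧
      leraySchauderDegree (fun x : ∀ j, E j => x - fun i => F A i x) (Set.univ.pi Ω) p =
        leraySchauderDegree (fun x : ∀ j, E j => x - fun i => T i x) (Set.univ.pi Ω) p := by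
    intro A
    induction A using Finset.induction with
    | empty => simpa [F] using h
    | insert a A ha ih =>
      have hF : F (insert a A) = freezeComponent (F A) a y := by
        funext i x
        rcases eq_or_ne i a with rfl | hi
        · simp [F, freezeComponent, ha]
        · simp [F, freezeComponent, hi]
      rw [hF]
      exact ⟨ih.1.freeze a (pi_subset_pi_closure hy),
        (ih.1.leraySchauderDegree_freeze ho hb a hy hc hcΩ hc0 hc1).trans ih.2⟩
  simpa [F] using (key Finset.univ).2

end Systems

/-! ### The frozen components and the main theorem. -/

section Main
variable {k : ℕ} {E : Fin k → Type*} [∀ i, NormedAddCommGroup (E i)]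
  {Ω : ∀ i, Set (E i)} {G : ∀ i, (∀ j, E j) → E i} {p : ∀ i, E i}

theorem IsCompactMapOn.isCompact_closure_image {X Y : Type*} [NormedAddCommGroup X]
    [NormedAddCommGroup Y] {T : X → Y} {A : Set X} (h : IsCompactMapOn T A)
    (hA : Bornology.IsBounded A) : IsCompact (closure (T '' A)) :=
  h.2 A le_rfl hA

theorem isBounded_pi_closure (hbdd : ∀ i, Bornology.IsBounded (Ω i)) :
    Bornology.IsBounded (Set.univ.pi fun j => closure (Ω j)) :=
  Bornology.IsBounded.pi fun i => (hbdd i).closure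

theorem update_mem_pi_closure_of_mem {x : ∀ j, E j} (hx : x ∈ Set.univ.pi Ω) {i : Fin k} {z : E i}
    (hz : z ∈ closure (Ω i)) :
    Function.update x i z ∈ Set.univ.pi fun j => closure (Ω j) := by
  intro j _
  rcases eq_or_ne j i with rfl | h
  · simpa using hz
  · simpa [h] using subset_closure (hx j trivial)

theorem continuousOn_frozen (hG : ∀ i, IsCompactMapOn (G i) (Set.univ.pi fun j => closure (Ω j)))
    (i : Fin k) : ContinuousOn (Function.uncurry fun (x : ∀ j, E j) (z : E i) =>
      G i (Function.update x i z)) (Set.univ.pi Ω ×ˢ closure (Ω i)) :=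
  (hG i).1.comp (continuous_fst.update i continuous_snd).continuousOn fun _ hq =>
    update_mem_pi_closure_of_mem hq.1 hq.2

/-- Compactness jointly in the parameter and the variable, as homotopy invariance over the product
of the `Ω i` requires. -/
theorem isCompact_frozen (hbdd : ∀ i, Bornology.IsBounded (Ω i))
    (hG : ∀ i, IsCompactMapOn (G i) (Set.univ.pi fun j => closure (Ω j))) (i : Fin k) :
    IsCompact (closure (Function.uncurry (fun (x : ∀ j, E j) (z : E i) =>
      G i (Function.update x i z)) '' (Set.univ.pi Ω ×ˢ closure (Ω i)))) := by
  refine ((hG i).isCompact_closure_image (isBounded_pi_closure hbdd)).of_isClosed_subset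
    isClosed_closure (closure_mono ?_)
  rintro _ ⟨q, hq, rfl⟩
  exact ⟨_, update_mem_pi_closure_of_mem hq.1 hq.2, rfl⟩

theorem frozen_ne (hp : ∀ i, ∀ x : ∀ j, E j, x i ∈ frontier (Ω i) → (∀ j, j ≠ i → x j ∈ Ω j) →
      x i - G i x ≠ p i) (i : Fin k) {x : ∀ j, E j} (hx : x ∈ Set.univ.pi Ω) {z : E i}
    (hz : z ∈ frontier (Ω i)) : z - G i (Function.update x i z) ≠ p i := by
  have := hp i (Function.update x i z) (by simpa using hz)
    (fun j hj => by simpa [hj] using hx j trivial)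
  simpa using this

theorem continuousOn_frozen_apply
    (hG : ∀ i, IsCompactMapOn (G i) (Set.univ.pi fun j => closure (Ω j)))
    (i : Fin k) {x : ∀ j, E j} (hx : x ∈ Set.univ.pi Ω) :
    ContinuousOn (fun z => G i (Function.update x i z)) (closure (Ω i)) :=
  (continuousOn_frozen hG i).comp (by fun_prop : Continuous fun z : E i => (x, z)).continuousOn
    fun _ hz => ⟨hx, hz⟩

theorem isCompact_frozen_apply (hbdd : ∀ i, Bornology.IsBounded (Ω i))
    (hG : ∀ i, IsCompactMapOn (G i) (Set.univ.pi fun j => closure (Ω j)))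
    (i : Fin k) {x : ∀ j, E j} (hx : x ∈ Set.univ.pi Ω) :
    IsCompact (closure ((fun z => G i (Function.update x i z)) '' closure (Ω i))) := by
  refine (isCompact_frozen hbdd hG i).of_isClosed_subset isClosed_closure (closure_mono ?_)
  rintro _ ⟨z, hz, rfl⟩
  exact ⟨(x, z), ⟨hx, hz⟩, rfl⟩

end Main

theorem mainTheorem8 {k : ℕ} {E : Fin k → Type*}
    [∀ i, NormedAddCommGroup (E i)] [∀ i, NormedSpace ℝ (E i)] [∀ i, CompleteSpace (E i)]
    (Ω : ∀ i, Set (E i))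
    (hopen : ∀ i, IsOpen (Ω i))
    (hbdd : ∀ i, Bornology.IsBounded (Ω i))
    (hcontr : ∀ i, ContractibleSpace (Ω i))
    (G : ∀ i, (∀ j, E j) → E i)
    (hG : ∀ i, IsCompactMapOn (G i) (Set.univ.pi fun j => closure (Ω j)))
    (p : ∀ i, E i)
    (hp : ∀ i, ∀ x : ∀ j, E j, x i ∈ frontier (Ω i) → (∀ j, j ≠ i → x j ∈ Ω j) →
      x i - G i x ≠ p i) :
    -- each component degree is well defined and independent of the frozen variables
    (∀ i, ∀ x ∈ Set.univ.pi Ω,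
      (∃! d : ℤ, IsLeraySchauderDegree (frozenComponent G i x) (Ω i) (p i) d) ∧
      ∀ y ∈ Set.univ.pi Ω,
        leraySchauderDegree (frozenComponent G i x) (Ω i) (p i) =
          leraySchauderDegree (frozenComponent G i y) (Ω i) (p i)) ∧
    -- if the boundary condition holds on the closed pieces, then the degree of the product map
    -- is well defined and is the product of the component degrees
    ((∀ i, ∀ x : ∀ j, E j, x i ∈ frontier (Ω i) → (∀ j, j ≠ i → x j ∈ closure (Ω j)) →
        x i - G i x ≠ p i) →
      (∃! d : ℤ, IsLeraySchauderDegree (fun x : ∀ j, E j => x - fun i => G i x)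
        (Set.univ.pi Ω) p d) ∧
      ∀ x ∈ Set.univ.pi Ω,
        leraySchauderDegree (fun x : ∀ j, E j => x - fun i => G i x) (Set.univ.pi Ω) p =
          ∏ i, leraySchauderDegree (frozenComponent G i x) (Ω i) (p i)) := by
  have hconn : IsPreconnected (Set.univ.pi Ω) := isPreconnected_univ_pi fun i =>
    isPreconnected_iff_preconnectedSpace.2 inferInstance
  have hconst : ∀ i, ∀ x ∈ Set.univ.pi Ω, ∀ y ∈ Set.univ.pi Ω,
      leraySchauderDegree (frozenComponent G i x) (Ω i) (p i) =
        leraySchauderDegree (frozenComponent G i y) (Ω i) (p i) := fun i x hx y hy =>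
    leraySchauderDegree_eq_of_isPreconnected hconn (hopen i) (hbdd i) (continuousOn_frozen hG i)
      (isCompact_frozen hbdd hG i) (fun a ha z hz => frozen_ne hp i ha hz) hx hy
  refine ⟨fun i x hx => ⟨existsUnique_isLeraySchauderDegree (hopen i) (hbdd i)
    (continuousOn_frozen_apply hG i hx) (isCompact_frozen_apply hbdd hG i hx)
    fun z hz => frozen_ne hp i hx hz, hconst i x hx⟩, fun hp' => ?_⟩
  have hadm : IsAdmissibleFamily Ω G p := by
    refine ⟨fun i => (hG i).1,
      fun i => (hG i).isCompact_closure_image (isBounded_pi_closure hbdd), fun i x hx hxp => ?_⟩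
    by_contra hxi
    exact hp' i x ((hopen i).frontier_eq ▸ ⟨hx i trivial, hxi⟩) (fun j _ => hx j trivial) hxp
  refine ⟨existsUnique_isLeraySchauderDegree (T := fun x i => G i x)
    (isOpen_set_pi Set.finite_univ fun i _ => hopen i) (Bornology.IsBounded.pi hbdd)
    hadm.continuousOn_pi hadm.isCompact_pi fun x hx hxp => ?_, fun x hx => ?_⟩
  · obtain ⟨hcl, i, hi⟩ := exists_mem_frontier_of_mem_frontier_pi hopen hx
    exact hp' i x hi (fun j _ => hcl j) (congrFun hxp i)
  · choose y hy c hc hcΩ hc0 hc1 using fun i => exists_contraction (Ω i)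
    have hyΩ : y ∈ Set.univ.pi Ω := fun i _ => hy i
    -- The base point `y` is dictated by the contractions; the constancy from (a) moves the result
    -- from `y` to `x`.
    rw [← hadm.leraySchauderDegree_freeze_all hopen hbdd hyΩ hc hcΩ hc0 hc1,
      leraySchauderDegree_pi (T := fun i z => G i (Function.update y i z)) hopen hbdd
        (fun i => continuousOn_frozen_apply hG i hyΩ)
        (fun i => isCompact_frozen_apply hbdd hG i hyΩ) fun i z hz => frozen_ne hp i hyΩ hz]
    exact Finset.prod_congr rfl fun i _ => hconst i y hyΩ x hx
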